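/- Let $N$ be a nonnegative integer, let $a_1,\dots,a_N$ be complex numbers and let $\lambda_1,\dots,\lambda_N$ be real numbers with $\lambda_{k+1}\ge\lambda_k+1$ for $1\le k\le N-1$. Put $P(t)=\sum_{k=1}^N a_k e^{2i\pi\lambda_k t}$ for $t\in\mathbb{R}$, let $T\ge 72$ be a real number, and let $\Gamma$ be the curve in the complex plane parametrized by $t\mapsto P(t)$, $t\in[0,T]$. Let $\ell(\Gamma)$ denote the length of this parametrized curve, that is, the supremum of $\sum_{i=0}^{n-1}|P(t_{i+1})-P(t_i)|$ over all finite sequences $0\le t_0\le t_1\le\dots\le t_n\le T$ (so arcs that are traversed several times are counted with multiplicity). Then $$ \ell(\Gamma)=\int_0^T|P'(t)|\,\mathrm{d}t\ \ge\ \frac{T}{20}\sum_{k=1}^N\frac{|\lambda_k|\,|a_k|}{k}. $$ -/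

import Mathlib

/-- The non-harmonic trigonometric polynomial
`t ↦ ∑_{k=1}^N a_k e^{2 i π λ_k t}` (only the indices `1, …, N` are used). -/
noncomputable def trigPoly (N : ℕ) (a : ℕ → ℂ) (lam : ℕ → ℝ) (t : ℝ) : ℂ :=
  ∑ k ∈ Finset.Icc 1 N, a k * Complex.exp (2 * Complex.I * Real.pi * lam k * t)

/-- The length of the parametrized curve `γ : [a, b] → ℂ`: the supremum of the lengths
of the inscribed polygonal lines, as an extended nonnegative real. -/
noncomputable def curveLength (γ : ℝ → ℂ) (a b : ℝ) : ENNReal :=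
  eVariationOn γ (Set.Icc a b)

/-!
The length formula holds for every continuously differentiable curve: chords over short intervals
differ from arcs by the oscillation of the derivative
(`eVariationOn_Icc_eq_integral_norm_deriv`).

Since `P'(t) = 2πi ∑ λ_k a_k e^{2πi λ_k t}`, the lower bound is a nonharmonic Littlewood inequality.
After rescaling `[0, T]` to `[0, 1]` the frequencies `x_k = T λ_k` have gaps at least `72`, and the
claim follows from `∫₀¹ |φ| ≥ (1/120) ∑ |b_k| / k` for `φ(s) = ∑ b_k e^{2πi x_k s}`
(`sum_norm_div_le_integral_norm`), because `2π / 120 ≥ 1 / 20`. The proof follows the duality method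
of McGehee, Pigno and Smith: one constructs `F` with `|F| ≤ 6` on `[0, 1]` such that `∫ φ F` has
real part at least `(1/20) ∑ |b_k| / k`.

The indices are split into blocks `4^j ≤ l < 4^(j+1)`, and `f_j` (`blockPoly`) is the sum over the
block of the characters `e^{-2πi x_l s}`, with the phases conjugate to those of `b_l`, divided by
`3 * 4^j` and multiplied by the window `sin² (πs)`. Thus `|f_j| ≤ 1`, and `f_j` vanishes at the
endpoints. Since `|f_j|` is a continuous function on the circle `ℝ / ℤ`, density of trigonometric
polynomials gives an entire function `h_j` with `Re h_j ≥ |f_j|` on the unit circle, parametrized by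
`z = e^{2πis}`, and with mean square comparable to that of `f_j` (`exists_entire_re_ge`). The
test function is
`F = ∑_j f_j exp (-(1/5) ∑_{i > j} h_i)`; the damping factors keep it bounded by `6`
(`norm_sum_mul_exp_le_six`).

The coefficient `∫ e^{2πi x_k s} F(s) ds` has real part, after multiplication by the phase of
`b_k`, at least `1/2 - 27/100` times the weight `1 / (3 * 4^j) ≥ 1 / (3k)` of the block of `k`
(`norm_sum_integral_damped_blockPoly_sub_le`):
* for `j` at least the block of `k`, the damping factor can be replaced by `1`, since
  `|exp (-z) - 1| ≤ |z|` for `Re z ≥ 0` and `f_j` and `∑_{i > j} h_i` have mean square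
  `O(4^{-j})`;
* for smaller `j`, the damping factor has only nonnegative frequencies, so it pushes the already
  positive frequencies `x_k - x_l` further up, where the Fourier transform of the window is tiny
  (`norm_integral_bump_mul_entire_le`). This replaces the exact orthogonality of the harmonic
  case. It is here, and in the near orthogonality of the characters under the window
  (`norm_bumpTransform_sub_le`), that the lower bound on `T` enters.
-/

/-! ### The window and its Fourier transform -/

/-- The character `x ↦ exp (2πix)`. -/
noncomputable def unitExp (x : ℝ) : ℂ := Complex.exp (2 * Real.pi * x * Complex.I)

theorem unitExp_zero : unitExp 0 = 1 := by simp [unitExp]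

theorem unitExp_add (x y : ℝ) : unitExp (x + y) = unitExp x * unitExp y := by
  rw [unitExp, unitExp, unitExp, ← Complex.exp_add]
  push_cast
  ring_nf

theorem norm_unitExp (x : ℝ) : ‖unitExp x‖ = 1 := by
  have h : unitExp x = Complex.exp ((2 * Real.pi * x : ℝ) * Complex.I) := by
    simp [unitExp]
  rw [h, Complex.norm_exp_ofReal_mul_I]

theorem unitExp_pow (x : ℝ) (n : ℕ) : unitExp x ^ n = unitExp (n * x) := by
  rw [unitExp, unitExp, ← Complex.exp_nat_mul]
  push_cast
  ring_nf

theorem continuous_unitExp : Continuous unitExp := by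
  unfold unitExp
  fun_prop

theorem conj_unitExp (x : ℝ) : (starRingEnd ℂ) (unitExp x) = unitExp (-x) := by
  rw [unitExp, unitExp, ← Complex.exp_conj]
  simp [Complex.conj_ofNat]

theorem integral_unitExp_mul {x : ℝ} (hx : x ≠ 0) :
    ∫ s in (0 : ℝ)..1, unitExp (x * s) = (unitExp x - 1) / (2 * Real.pi * x * Complex.I) := by
  have hc : (2 * Real.pi * x * Complex.I : ℂ) ≠ 0 := by
    simp [Real.pi_ne_zero, hx]
  have h := integral_exp_mul_complex (a := 0) (b := 1) hc
  have h1 : ∀ s : ℝ, unitExp (x * s) = Complex.exp (2 * Real.pi * x * Complex.I * s) := by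
    intro s
    rw [unitExp]
    push_cast
    ring_nf
  simp only [h1]
  rw [h]
  simp [unitExp]

/-- The window `sin² (πs)` on `[0, 1]`. It vanishes at both endpoints together with its
derivative, which makes its Fourier transform decay like the inverse cube of the frequency. -/
noncomputable def bump (s : ℝ) : ℝ := Real.sin (Real.pi * s) ^ 2

theorem continuous_bump : Continuous bump := by
  unfold bump
  fun_prop

theorem bump_nonneg (s : ℝ) : 0 ≤ bump s := sq_nonneg _

theorem bump_le_one (s : ℝ) : bump s ≤ 1 := Real.sin_sq_le_one _

theorem bump_zero : bump 0 = 0 := by simp [bump]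

theorem bump_one : bump 1 = 0 := by simp [bump]

theorem bump_eq_unitExp (s : ℝ) :
    (bump s : ℂ) = 1 / 2 - unitExp s / 4 - unitExp (-s) / 4 := by
  have h1 : bump s = 1 / 2 - Real.cos (2 * Real.pi * s) / 2 := by
    rw [bump, Real.sin_sq_eq_half_sub]
    ring_nf
  rw [h1]
  push_cast
  rw [Complex.cos, unitExp, unitExp]
  push_cast
  ring_nf

theorem integral_bump : ∫ s in (0 : ℝ)..1, (bump s : ℂ) = 1 / 2 := by
  have h1 : ∀ s : ℝ, (bump s : ℂ) = 1 / 2 - unitExp (1 * s) / 4 - unitExp ((-1) * s) / 4 := by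
    intro s
    rw [bump_eq_unitExp]
    simp
  have hi : ∀ y : ℝ, IntervalIntegrable (fun s : ℝ => unitExp (y * s)) MeasureTheory.volume 0 1 :=
    fun y => (continuous_unitExp.comp (continuous_const.mul continuous_id)).intervalIntegrable _ _
  have h2 : unitExp 1 = 1 := by simp [unitExp]
  have h3 : unitExp (-1) = 1 := by simp [unitExp, Complex.exp_neg]
  simp only [h1]
  rw [intervalIntegral.integral_sub, intervalIntegral.integral_sub,
    intervalIntegral.integral_div, intervalIntegral.integral_div, intervalIntegral.integral_div,
    integral_unitExp_mul one_ne_zero, integral_unitExp_mul (by norm_num), h2, h3]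
  · simp
  · simp
  · exact (hi 1).div_const 4
  · exact (by simp : IntervalIntegrable (fun _ : ℝ => (1 / 2 : ℂ)) _ _ _).sub ((hi 1).div_const 4)
  · exact (hi (-1)).div_const 4

/-- The Fourier transform of the window `bump`. -/
noncomputable def bumpTransform (x : ℝ) : ℂ := ∫ s in (0 : ℝ)..1, (bump s : ℂ) * unitExp (x * s)

theorem bumpTransform_zero : bumpTransform 0 = 1 / 2 := by
  simpa only [bumpTransform, zero_mul, unitExp_zero, mul_one] using integral_bump

theorem bumpTransform_eq {x : ℝ} (hx : 1 < |x|) :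
    bumpTransform x = -(unitExp x - 1) / (4 * Real.pi * Complex.I * (x * (x ^ 2 - 1))) := by
  have h0 : x ≠ 0 := by
    rintro rfl
    norm_num at hx
  have h1 : x + 1 ≠ 0 := by
    intro h
    have : x = -1 := by linarith
    rw [this] at hx
    norm_num at hx
  have h2 : x - 1 ≠ 0 := by
    intro h
    have : x = 1 := by linarith
    rw [this] at hx
    norm_num at hx
  have hi : ∀ y : ℝ, IntervalIntegrable (fun s : ℝ => unitExp (y * s)) MeasureTheory.volume 0 1 :=
    fun y => (continuous_unitExp.comp (continuous_const.mul continuous_id)).intervalIntegrable _ _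
  have e1 : unitExp (x + 1) = unitExp x := by
    rw [unitExp_add]
    simp [unitExp]
  have e2 : unitExp (x - 1) = unitExp x := by
    rw [sub_eq_add_neg, unitExp_add]
    simp [unitExp, Complex.exp_neg]
  have h3 : ∀ s : ℝ, (bump s : ℂ) * unitExp (x * s) =
      unitExp (x * s) / 2 - unitExp ((x + 1) * s) / 4 - unitExp ((x - 1) * s) / 4 := by
    intro s
    have a1 : (x + 1) * s = x * s + s := by ring
    have a2 : (x - 1) * s = x * s + -s := by ring
    rw [bump_eq_unitExp, a1, a2, unitExp_add, unitExp_add]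
    ring
  rw [bumpTransform]
  simp only [h3]
  rw [intervalIntegral.integral_sub, intervalIntegral.integral_sub,
    intervalIntegral.integral_div, intervalIntegral.integral_div, intervalIntegral.integral_div,
    integral_unitExp_mul h0, integral_unitExp_mul h1, integral_unitExp_mul h2, e1, e2]
  · have c0 : (x : ℂ) ≠ 0 := by exact_mod_cast h0
    have c1 : (x : ℂ) + 1 ≠ 0 := by exact_mod_cast h1
    have c2 : (x : ℂ) - 1 ≠ 0 := by exact_mod_cast h2
    have c3 : (x : ℂ) ^ 2 - 1 ≠ 0 := by
      have : (x : ℂ) ^ 2 - 1 = (x + 1) * (x - 1) := by ring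
      rw [this]
      exact mul_ne_zero c1 c2
    have c4 : (Real.pi : ℂ) ≠ 0 := by exact_mod_cast Real.pi_ne_zero
    push_cast
    field_simp
    ring
  · exact (hi x).div_const 2
  · exact (hi (x + 1)).div_const 4
  · exact ((hi x).div_const 2).sub ((hi (x + 1)).div_const 4)
  · exact (hi (x - 1)).div_const 4

theorem norm_bumpTransform_le {x : ℝ} (hx : 1 < |x|) :
    ‖bumpTransform x‖ ≤ 1 / (2 * Real.pi * (|x| * (|x| ^ 2 - 1))) := by
  have hp : 0 < |x| ^ 2 - 1 := by nlinarith
  have hpi := Real.pi_pos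
  rw [bumpTransform_eq hx, norm_div, norm_neg]
  have h1 : ‖unitExp x - 1‖ ≤ 2 := by
    calc ‖unitExp x - 1‖ ≤ ‖unitExp x‖ + ‖(1 : ℂ)‖ := norm_sub_le _ _
      _ = 2 := by rw [norm_unitExp]; norm_num
  have h2 : ‖(4 * Real.pi * Complex.I * (x * (x ^ 2 - 1)) : ℂ)‖ =
      4 * Real.pi * (|x| * (|x| ^ 2 - 1)) := by
    have : (x * (x ^ 2 - 1) : ℂ) = ((x * (x ^ 2 - 1) : ℝ) : ℂ) := by push_cast; ring
    rw [this, norm_mul, Complex.norm_real, norm_mul (x : ℝ)]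
    rw [sq_abs] at hp ⊢
    simp [abs_of_pos hp, abs_of_pos hpi]
  have hx0 : 0 < |x| := by linarith
  rw [h2, div_le_div_iff₀ (by positivity) (by positivity)]
  nlinarith [mul_pos hpi (mul_pos hx0 hp)]

/-- The telescoping series behind the estimate of `norm_integral_bump_mul_entire_le`. -/
theorem hasSum_telescope {x : ℝ} (hx : 1 < x) :
    HasSum (fun n : ℕ => 1 / (2 * Real.pi * ((x + n) * ((x + n) ^ 2 - 1))))
      (1 / (4 * Real.pi * (x * (x - 1)))) := by
  have hpi := Real.pi_pos
  have hpos : ∀ n : ℕ, 0 < x + n - 1 := fun n => by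
    have : (0 : ℝ) ≤ n := n.cast_nonneg
    linarith
  rw [hasSum_iff_tendsto_nat_of_nonneg]
  · have hs : ∀ n : ℕ, ∑ i ∈ Finset.range n,
        1 / (2 * Real.pi * ((x + i) * ((x + i) ^ 2 - 1))) =
        1 / (4 * Real.pi * (x * (x - 1))) - 1 / (4 * Real.pi * ((x + n) * (x + n - 1))) := by
      intro n
      induction n with
      | zero => simp
      | succ n ih =>
        rw [Finset.sum_range_succ, ih]
        have h1 := hpos n
        have h2 : 0 < x + n := by linarith
        have h3 : 0 < x + n + 1 := by linarith
        have h4 : (x + n) ^ 2 - 1 ≠ 0 := by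
          have : (x + n) ^ 2 - 1 = (x + n - 1) * (x + n + 1) := by ring
          rw [this]
          positivity
        have h5 : x + (n + 1 : ℕ) - 1 = x + n := by push_cast; ring
        have h6 : x + (n + 1 : ℕ) = x + n + 1 := by push_cast; ring
        have h7 : (x + n) ^ 2 - 1 = (x + n - 1) * (x + n + 1) := by ring
        rw [h5, h6, h7, sub_add, sub_right_inj]
        field_simp
        ring
    simp only [hs]
    have ht : Filter.Tendsto (fun n : ℕ => 1 / (4 * Real.pi * ((x + n) * (x + n - 1))))
        Filter.atTop (nhds 0) := by
      simp only [one_div]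
      apply Filter.Tendsto.inv_tendsto_atTop
      apply Filter.Tendsto.const_mul_atTop (by positivity)
      apply Filter.Tendsto.atTop_mul_atTop₀
      · exact Filter.tendsto_atTop_add_const_left _ _ tendsto_natCast_atTop_atTop
      · simp only [add_sub_right_comm x _ 1]
        exact Filter.tendsto_atTop_add_const_left _ _ tendsto_natCast_atTop_atTop
    simpa using ht.const_sub (1 / (4 * Real.pi * (x * (x - 1))))
  · intro n
    have h1 := hpos n
    have h2 : 0 < x + n := by linarith
    have h3 : 0 < x + n + 1 := by linarith
    have h7 : (x + n) ^ 2 - 1 = (x + n - 1) * (x + n + 1) := by ring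
    rw [h7]
    positivity

/-- An entire function bounded by `1` on the unit circle only contributes nonnegative frequencies,
so multiplying by it pushes the frequency `x > 1` further away from zero. Its Taylor coefficients
are bounded by `1`, and the resulting series of Fourier transforms is majorized by a telescoping
series. -/
theorem norm_integral_bump_mul_entire_le {G : ℂ → ℂ} (hG : Differentiable ℂ G)
    (hb : ∀ z, ‖z‖ = 1 → ‖G z‖ ≤ 1) {x : ℝ} (hx : 1 < x) :
    ‖∫ s in (0 : ℝ)..1, (bump s : ℂ) * unitExp (x * s) * G (unitExp s)‖ ≤
      1 / (4 * Real.pi * (x * (x - 1))) := by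
  set c : ℕ → ℂ := fun n => (n.factorial : ℂ)⁻¹ * iteratedDeriv n G 0 with hc
  have hfac : ∀ n : ℕ, (0 : ℝ) < n.factorial := fun n => by exact_mod_cast n.factorial_pos
  have hc1 : ∀ n, ‖c n‖ ≤ 1 := by
    intro n
    have h := Complex.norm_iteratedDeriv_le_of_forall_mem_sphere_norm_le (c := 0) (R := 1) (C := 1)
      (f := G) n one_pos hG.diffContOnCl (fun z hz => hb z (by simpa using hz))
    rw [hc]
    simp only [norm_mul, norm_inv, Complex.norm_natCast]
    rw [inv_mul_le_iff₀ (hfac n)]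
    simpa using h
  have hsummable : Summable fun n => ‖c n‖ := by
    -- the Cauchy estimates on the circle of radius `2` give geometric decay
    obtain ⟨C, hC⟩ := (isCompact_sphere (0 : ℂ) 2).exists_bound_of_continuousOn
      hG.continuous.continuousOn
    have h2 : ∀ n, ‖c n‖ ≤ C * (1 / 2 : ℝ) ^ n := by
      intro n
      have h := Complex.norm_iteratedDeriv_le_of_forall_mem_sphere_norm_le (c := 0) (R := 2)
        (C := C) (f := G) n two_pos hG.diffContOnCl (fun z hz => hC z hz)
      rw [hc]
      simp only [norm_mul, norm_inv, Complex.norm_natCast]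
      rw [inv_mul_le_iff₀ (hfac n)]
      refine h.trans (le_of_eq ?_)
      rw [div_pow, one_pow]
      ring
    exact Summable.of_nonneg_of_le (fun n => norm_nonneg _) h2
      ((summable_geometric_of_lt_one (by norm_num) (by norm_num)).mul_left C)
  have hseries : ∀ z, HasSum (fun n => c n * z ^ n) (G z) := by
    intro z
    have h := Complex.hasSum_taylorSeries_of_entire hG 0 z
    simp only [sub_zero, smul_eq_mul] at h
    refine h.congr_fun ?_
    intro n
    simp only [hc]
    ring
  have hsum : HasSum (fun n : ℕ => ∫ s in (0 : ℝ)..1,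
      (bump s : ℂ) * unitExp (x * s) * (c n * unitExp s ^ n))
      (∫ s in (0 : ℝ)..1, (bump s : ℂ) * unitExp (x * s) * G (unitExp s)) := by
    apply intervalIntegral.hasSum_integral_of_dominated_convergence (fun n _ => ‖c n‖)
    · intro n
      have := continuous_bump
      have := continuous_unitExp
      have h : Continuous fun s : ℝ => (bump s : ℂ) * unitExp (x * s) * (c n * unitExp s ^ n) := by
        fun_prop
      exact h.aestronglyMeasurable
    · intro n
      refine Filter.Eventually.of_forall fun s _ => ?_
      simp only [norm_mul, norm_pow, norm_unitExp, one_pow, mul_one, Complex.norm_real]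
      rw [Real.norm_of_nonneg (bump_nonneg s)]
      exact mul_le_of_le_one_left (norm_nonneg _) (bump_le_one s)
    · exact Filter.Eventually.of_forall fun _ _ => hsummable
    · simp
    · exact Filter.Eventually.of_forall fun s _ => (hseries _).mul_left _
  have hterm : ∀ n : ℕ, ∫ s in (0 : ℝ)..1,
      (bump s : ℂ) * unitExp (x * s) * (c n * unitExp s ^ n) = c n * bumpTransform (x + n) := by
    intro n
    rw [bumpTransform, ← intervalIntegral.integral_const_mul]
    congr 1
    ext s
    rw [unitExp_pow, add_mul, unitExp_add]
    ring
  simp only [hterm] at hsum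
  rw [← hsum.tsum_eq]
  refine tsum_of_norm_bounded (hasSum_telescope hx) fun n => ?_
  have hn : 1 < |x + n| := by
    have : (0 : ℝ) ≤ n := n.cast_nonneg
    rw [abs_of_pos] <;> linarith
  have h := norm_bumpTransform_le hn
  rw [abs_of_pos (by have : (0 : ℝ) ≤ n := n.cast_nonneg
                     linarith)] at h
  rw [norm_mul]
  calc ‖c n‖ * ‖bumpTransform (x + n)‖ ≤ 1 * ‖bumpTransform (x + n)‖ :=
        mul_le_mul_of_nonneg_right (hc1 n) (norm_nonneg _)
    _ ≤ _ := by simpa using h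

theorem one_div_telescope_le {d x : ℝ} (hd : 1 ≤ d) (hx : 72 * d ≤ x) :
    1 / (4 * Real.pi * (x * (x - 1))) ≤ 1 / (1000 * d ^ 2) := by
  have hpi := Real.pi_gt_three
  have h1 : 1000 * d ^ 2 ≤ x * (x - 1) := by nlinarith
  have h0 : 0 < 1000 * d ^ 2 := by positivity
  apply one_div_le_one_div_of_le h0
  nlinarith

theorem norm_integral_bump_mul_entire_le_of_gap {G : ℂ → ℂ} (hG : Differentiable ℂ G)
    (hb : ∀ z, ‖z‖ = 1 → ‖G z‖ ≤ 1) {d x : ℝ} (hd : 1 ≤ d) (hx : 72 * d ≤ x) :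
    ‖∫ s in (0 : ℝ)..1, (bump s : ℂ) * unitExp (x * s) * G (unitExp s)‖ ≤ 1 / (1000 * d ^ 2) :=
  (norm_integral_bump_mul_entire_le hG hb (by linarith)).trans (one_div_telescope_le hd hx)

theorem norm_bumpTransform_le_of_gap {d x : ℝ} (hd : 1 ≤ d) (hx : 72 * d ≤ |x|) :
    ‖bumpTransform x‖ ≤ 1 / (1000 * d ^ 2) := by
  have hpi := Real.pi_gt_three
  refine (norm_bumpTransform_le (by linarith)).trans ?_
  apply one_div_le_one_div_of_le (by positivity)
  have h1 : 1000 * d ^ 2 ≤ |x| ^ 2 - 1 := by nlinarith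
  have h2 : |x| ^ 2 - 1 ≤ |x| * (|x| ^ 2 - 1) := by nlinarith
  nlinarith

/-! ### Entire majorants on the unit circle -/

theorem integral_comp_unitExp_of_differentiable {h : ℂ → ℂ} (hh : Differentiable ℂ h) :
    ∫ s in (0 : ℝ)..1, h (unitExp s) = h 0 := by
  have h1 := (hh.diffContOnCl (s := Metric.ball 0 |1|)).circleAverage (R := 1) (c := 0)
  rw [Real.circleAverage_def] at h1
  have h2 := intervalIntegral.smul_integral_comp_mul_left (a := 0) (b := 1)
    (fun θ => h (circleMap 0 1 θ)) (2 * Real.pi)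
  rw [mul_zero, mul_one] at h2
  rw [← h2, smul_smul, inv_mul_cancel₀ (by positivity), one_smul] at h1
  rw [← h1]
  congr 1
  ext s
  simp [circleMap, unitExp]

/-- If `h` is entire and `h 0` is real then the mean of `h²` over the unit circle is
`(h 0)² ≥ 0`, so the imaginary part of `h` is dominated by its real part in mean square. -/
theorem integral_norm_sq_le_two_mul_integral_re_sq {h : ℂ → ℂ} (hh : Differentiable ℂ h)
    (h0 : (h 0).im = 0) :
    ∫ s in (0 : ℝ)..1, ‖h (unitExp s)‖ ^ 2 ≤ 2 * ∫ s in (0 : ℝ)..1, (h (unitExp s)).re ^ 2 := by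
  have hc : Continuous fun s : ℝ => h (unitExp s) := hh.continuous.comp continuous_unitExp
  have hm := integral_comp_unitExp_of_differentiable (hh.pow 2)
  have hre : ∫ s in (0 : ℝ)..1, (h (unitExp s) ^ 2).re = (h 0 ^ 2).re := by
    have := Complex.reCLM.intervalIntegral_comp_comm
      ((hc.pow 2).intervalIntegrable (μ := MeasureTheory.volume) 0 1)
    simp only [Complex.reCLM_apply, Pi.pow_apply] at this hm
    rw [this, hm]
  have hnn : 0 ≤ (h 0 ^ 2).re := by
    rw [pow_two, Complex.mul_re, h0]
    nlinarith [sq_nonneg (h 0).re]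
  have hpt : ∀ s : ℝ, ‖h (unitExp s)‖ ^ 2 =
      2 * (h (unitExp s)).re ^ 2 - (h (unitExp s) ^ 2).re := by
    intro s
    rw [Complex.sq_norm, Complex.normSq_apply, pow_two (h (unitExp s)), Complex.mul_re]
    ring
  simp only [hpt]
  rw [intervalIntegral.integral_sub, intervalIntegral.integral_const_mul, hre]
  · linarith
  · exact (((Complex.continuous_re.comp hc).pow 2).const_mul 2).intervalIntegrable _ _
  · exact (Complex.continuous_re.comp (hc.pow 2)).intervalIntegrable _ _

/-- The real part of a trigonometric polynomial is the boundary value of the real part of an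
entire function: conjugate the terms of negative frequency. The scalar `c` makes the
statement stable under linear combinations. -/
theorem exists_entire_re_eq {f : C(AddCircle (1 : ℝ), ℂ)}
    (hf : f ∈ Submodule.span ℂ (Set.range (@fourier 1))) :
    ∀ c : ℂ, ∃ h : ℂ → ℂ, Differentiable ℂ h ∧ (h 0).im = 0 ∧
      ∀ s : ℝ, (h (unitExp s)).re = (c * f s).re := by
  induction hf using Submodule.span_induction with
  | mem f hf =>
    obtain ⟨n, rfl⟩ := hf
    intro c
    have hfn : ∀ s : ℝ, (fourier n (s : AddCircle (1 : ℝ)) : ℂ) = unitExp (n * s) := by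
      intro s
      rw [fourier_coe_apply, unitExp]
      push_cast
      ring_nf
    rcases lt_trichotomy n 0 with hn | hn | hn
    · obtain ⟨m, rfl⟩ : ∃ m : ℕ, n = -(m : ℤ) := ⟨n.natAbs, by omega⟩
      refine ⟨fun z => (starRingEnd ℂ) c * z ^ m, by fun_prop, ?_, fun s => ?_⟩
      · have : m ≠ 0 := by omega
        simp [this]
      · have : (starRingEnd ℂ) c * unitExp s ^ m = (starRingEnd ℂ) (c * unitExp (-(m * s))) := by
          rw [map_mul, conj_unitExp, unitExp_pow, neg_neg]
        simp only [hfn]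
        rw [this, Complex.conj_re]
        push_cast
        rw [neg_mul]
    · subst hn
      refine ⟨fun _ => (c.re : ℂ), by fun_prop, by simp, fun s => ?_⟩
      rw [hfn]
      simp [unitExp_zero]
    · obtain ⟨m, rfl⟩ : ∃ m : ℕ, n = (m : ℤ) := ⟨n.natAbs, by omega⟩
      refine ⟨fun z => c * z ^ m, by fun_prop, ?_, fun s => ?_⟩
      · have : m ≠ 0 := by omega
        simp [this]
      · simp only [hfn]
        rw [unitExp_pow]
        push_cast
        rfl
  | zero => exact fun c => ⟨fun _ => 0, by fun_prop, by simp, fun s => by simp⟩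
  | add f g _ _ ihf ihg =>
    intro c
    obtain ⟨h₁, d₁, i₁, r₁⟩ := ihf c
    obtain ⟨h₂, d₂, i₂, r₂⟩ := ihg c
    refine ⟨fun z => h₁ z + h₂ z, d₁.add d₂, by simp [i₁, i₂], fun s => ?_⟩
    simp only [Complex.add_re, r₁, r₂, ContinuousMap.add_apply, mul_add]
  | smul a f _ ih =>
    intro c
    obtain ⟨h, d, i, r⟩ := ih (c * a)
    refine ⟨h, d, i, fun s => ?_⟩
    rw [r, ContinuousMap.smul_apply, smul_eq_mul, mul_assoc]

/-- A substitute for the Herglotz transform of `g`: an entire function whose real part majorizes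
`g` on the unit circle and whose mean square is almost controlled by that of `g`. -/
theorem exists_entire_re_ge {g : ℝ → ℝ} (hg : ContinuousOn g (Set.Icc 0 1)) (h01 : g 0 = g 1)
    (hg0 : ∀ s ∈ Set.Icc (0 : ℝ) 1, 0 ≤ g s) (hg1 : ∀ s ∈ Set.Icc (0 : ℝ) 1, g s ≤ 1)
    {η : ℝ} (hη : 0 < η) :
    ∃ h : ℂ → ℂ, Differentiable ℂ h ∧ (∀ s ∈ Set.Icc (0 : ℝ) 1, g s ≤ (h (unitExp s)).re) ∧
      ∫ s in (0 : ℝ)..1, ‖h (unitExp s)‖ ^ 2 ≤ 2 * (∫ s in (0 : ℝ)..1, g s ^ 2) + η := by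
  set δ : ℝ := min 1 (η / 16) with hδ
  have hδ0 : 0 < δ := lt_min one_pos (by positivity)
  have hδ1 : δ ≤ 1 := min_le_left _ _
  have hδη : 16 * δ ≤ η := by
    have := min_le_right 1 (η / 16)
    linarith
  let gc : C(AddCircle (1 : ℝ), ℂ) := ⟨AddCircle.liftIco 1 0 fun s => (g s : ℂ),
    AddCircle.liftIco_zero_continuous (by rw [h01])
      (Complex.continuous_ofReal.comp_continuousOn hg)⟩
  have hgc : ∀ s ∈ Set.Icc (0 : ℝ) 1, gc s = (g s : ℂ) := by
    intro s hs
    rcases hs.2.lt_or_eq with h | h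
    · exact AddCircle.liftIco_zero_coe_apply (f := fun s => (g s : ℂ)) ⟨hs.1, h⟩
    · subst h
      have h2 : ((1 : ℝ) : AddCircle (1 : ℝ)) = ((0 : ℝ) : AddCircle (1 : ℝ)) := by
        simp [AddCircle.coe_period]
      rw [h2, ← h01]
      exact AddCircle.liftIco_zero_coe_apply (f := fun s => (g s : ℂ)) ⟨le_rfl, one_pos⟩
  have hmem : gc ∈ closure
      (Submodule.span ℂ (Set.range (@fourier 1)) : Set C(AddCircle (1 : ℝ), ℂ)) := by
    rw [← Submodule.topologicalClosure_coe, span_fourier_closure_eq_top]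
    trivial
  obtain ⟨p, hp, hdist⟩ := Metric.mem_closure_iff.1 hmem δ hδ0
  obtain ⟨h, hd, hi, hr⟩ := exists_entire_re_eq hp 1
  have hclose : ∀ s ∈ Set.Icc (0 : ℝ) 1, |g s - (h (unitExp s)).re| ≤ δ := by
    intro s hs
    have h1 : ‖gc s - p s‖ ≤ δ := by
      rw [← dist_eq_norm]
      exact (ContinuousMap.dist_apply_le_dist _).trans hdist.le
    rw [hr, one_mul]
    have h2 := (Complex.abs_re_le_norm (gc s - p s)).trans h1
    rwa [hgc s hs, Complex.sub_re, Complex.ofReal_re] at h2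
  have hdδ : Differentiable ℂ fun z => h z + (δ : ℂ) := by fun_prop
  -- adding `δ` turns the approximation of `g` up to `δ` into a majorant
  refine ⟨fun z => h z + (δ : ℂ), hdδ, fun s hs => ?_, ?_⟩
  · have := (abs_le.1 (hclose s hs)).2
    simp only [Complex.add_re, Complex.ofReal_re]
    linarith
  · refine (integral_norm_sq_le_two_mul_integral_re_sq hdδ (by simp [hi])).trans ?_
    have hint : IntervalIntegrable (fun s => g s ^ 2) MeasureTheory.volume 0 1 := by
      apply ContinuousOn.intervalIntegrable
      rw [Set.uIcc_of_le zero_le_one]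
      exact hg.pow 2
    have hle : ∫ s in (0 : ℝ)..1, (h (unitExp s) + (δ : ℂ)).re ^ 2 ≤
        ∫ s in (0 : ℝ)..1, (g s ^ 2 + 8 * δ) := by
      apply intervalIntegral.integral_mono_on zero_le_one
      · exact ((Complex.continuous_re.comp
          (hdδ.continuous.comp continuous_unitExp)).pow 2).intervalIntegrable _ _
      · exact hint.add (by simp)
      · intro s hs
        have h1 := abs_le.1 (hclose s hs)
        have h2 := hg0 s hs
        have h3 := hg1 s hs
        simp only [Complex.add_re, Complex.ofReal_re]
        have h4 : (h (unitExp s)).re + δ ≤ g s + 2 * δ := by linarith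
        have h5 : 0 ≤ (h (unitExp s)).re + δ := by linarith
        nlinarith [mul_le_mul h4 h4 h5 (by linarith)]
    rw [intervalIntegral.integral_add hint (by simp)] at hle
    simp only [intervalIntegral.integral_const, sub_zero, one_smul] at hle
    linarith

/-! ### Bounded test functions -/

theorem norm_exp_sub_one_le_of_re_nonpos {z : ℂ} (hz : z.re ≤ 0) : ‖Complex.exp z - 1‖ ≤ ‖z‖ := by
  have h := (convex_halfSpace_re_le 0).norm_image_sub_le_of_norm_deriv_le (𝕜 := ℂ)
    (f := Complex.exp) (C := 1) (x := 0) (y := z) (fun w _ => Complex.differentiableAt_exp)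
    (fun w hw => by
      rw [Complex.deriv_exp, Complex.norm_exp]
      exact Real.exp_le_one_iff.2 hw) (by simp) hz
  simpa using h

theorem exp_neg_div_five_le {x : ℝ} (h0 : 0 ≤ x) (h1 : x ≤ 1) :
    Real.exp (-(x / 5)) ≤ 1 - x / 6 := by
  rw [Real.exp_neg, inv_le_comm₀ (Real.exp_pos _) (by linarith)]
  refine le_trans ?_ (Real.add_one_le_exp (x / 5))
  rw [inv_le_iff_one_le_mul₀ (by linarith)]
  nlinarith

/-- The bounded test function: if `C e^{-x/5} + x ≤ C` for all `x ∈ [0, 1]`, as is the case for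
`C = 6`, then damping the current sum by `exp (-h/5)` makes room for a new term of size at most
`Re h`. -/
theorem norm_sum_mul_exp_le_six {f h : ℕ → ℂ} (hf : ∀ j, ‖f j‖ ≤ 1)
    (hfh : ∀ j, ‖f j‖ ≤ (h j).re) (J : ℕ) :
    ‖∑ j ∈ Finset.range J,
      f j * Complex.exp (-((∑ i ∈ Finset.Ico (j + 1) J, h i) / 5))‖ ≤ 6 := by
  induction J with
  | zero => simp
  | succ J ih =>
    have hstep : ∀ j ∈ Finset.range J,
        f j * Complex.exp (-((∑ i ∈ Finset.Ico (j + 1) (J + 1), h i) / 5)) =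
        f j * Complex.exp (-((∑ i ∈ Finset.Ico (j + 1) J, h i) / 5)) *
          Complex.exp (-(h J / 5)) := by
      intro j hj
      rw [Finset.sum_Ico_succ_top (Nat.succ_le_of_lt (Finset.mem_range.1 hj)), mul_assoc,
        ← Complex.exp_add, add_div, neg_add]
    rw [Finset.sum_range_succ, Finset.sum_congr rfl hstep, ← Finset.sum_mul]
    simp only [Finset.Ico_self, Finset.sum_empty, zero_div, neg_zero, Complex.exp_zero, mul_one]
    have he : ‖Complex.exp (-(h J / 5))‖ ≤ 1 - ‖f J‖ / 6 := by
      rw [Complex.norm_exp]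
      refine le_trans (Real.exp_le_exp.2 ?_) (exp_neg_div_five_le (norm_nonneg _) (hf J))
      have : (-(h J / 5)).re = -((h J).re / 5) := by simp
      rw [this]
      linarith [hfh J]
    refine (norm_add_le _ _).trans ?_
    rw [norm_mul]
    have := mul_le_mul ih he (norm_nonneg _) (by norm_num)
    linarith

/-! ### Blocks of indices -/

theorem sum_range_one_div_sq_le_two (n : ℕ) :
    ∑ d ∈ Finset.range n, 1 / ((d : ℝ) + 1) ^ 2 ≤ 2 := by
  have h : ∑ d ∈ Finset.range n, 1 / ((d : ℝ) + 1) ^ 2 ≤ 2 - 1 / ((n : ℝ) + 1 / 2) := by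
    induction n with
    | zero => norm_num
    | succ n ih =>
      rw [Finset.sum_range_succ]
      have h1 : 1 / ((n : ℝ) + 1) ^ 2 ≤
          1 / ((n : ℝ) + 1 / 2) - 1 / (((n + 1 : ℕ) : ℝ) + 1 / 2) := by
        push_cast
        have hn : (0 : ℝ) ≤ n := n.cast_nonneg
        rw [div_sub_div _ _ (by positivity) (by positivity),
          div_le_div_iff₀ (by positivity) (by positivity)]
        nlinarith
      linarith
  have : (0 : ℝ) ≤ 1 / ((n : ℝ) + 1 / 2) := by positivity
  linarith

theorem sum_Icc_one_div_sq_le_two (N : ℕ) : ∑ l ∈ Finset.Icc 1 N, 1 / (l : ℝ) ^ 2 ≤ 2 := by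
  have h : Finset.Icc 1 N = Finset.Ico 1 (N + 1) := by ext; simp
  rw [h, Finset.sum_Ico_eq_sum_range]
  refine le_trans (le_of_eq (Finset.sum_congr rfl fun d _ => ?_)) (sum_range_one_div_sq_le_two _)
  push_cast
  rw [add_comm]

theorem sum_one_div_sub_sq_le_four {S : Finset ℕ} {k : ℕ} (hk : k ∉ S) :
    ∑ l ∈ S, 1 / ((k : ℝ) - l) ^ 2 ≤ 4 := by
  obtain ⟨N, hN⟩ : ∃ N, S ⊆ Finset.range N :=
    ⟨_, fun l hl => Finset.mem_range.2 (Nat.lt_succ_of_le (Finset.le_sup (f := id) hl))⟩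
  have hsub : S ⊆ Finset.range k ∪ Finset.Ico (k + 1) N := by
    intro l hl
    have h1 := Finset.mem_range.1 (hN hl)
    have h2 : l ≠ k := fun h => hk (h ▸ hl)
    simp only [Finset.mem_union, Finset.mem_range, Finset.mem_Ico]
    omega
  refine (Finset.sum_le_sum_of_subset_of_nonneg hsub fun _ _ _ => by positivity).trans ?_
  rw [Finset.sum_union]
  · have h1 : ∑ l ∈ Finset.range k, 1 / ((k : ℝ) - l) ^ 2 ≤ 2 := by
      rw [← Finset.sum_range_reflect]
      refine le_trans (le_of_eq (Finset.sum_congr rfl fun d hd => ?_))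
        (sum_range_one_div_sq_le_two k)
      have : d + 1 ≤ k := Finset.mem_range.1 hd
      rw [Nat.sub_sub, Nat.cast_sub (by omega)]
      push_cast
      ring_nf
    have h2 : ∑ l ∈ Finset.Ico (k + 1) N, 1 / ((k : ℝ) - l) ^ 2 ≤ 2 := by
      rw [Finset.sum_Ico_eq_sum_range]
      refine le_trans (le_of_eq (Finset.sum_congr rfl fun d hd => ?_))
        (sum_range_one_div_sq_le_two (N - (k + 1)))
      push_cast
      ring_nf
    linarith
  · rw [Finset.disjoint_left]
    intro l
    simp only [Finset.mem_range, Finset.mem_Ico]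
    omega

/-- The weight of the frequencies of the block `4 ^ j ≤ l < 4 ^ (j + 1)`: the inverse of the number
`3 * 4 ^ j` of integers in the block. -/
noncomputable def blockWeight (j : ℕ) : ℝ := 1 / (3 * 4 ^ j)

theorem blockWeight_pos (j : ℕ) : 0 < blockWeight j := by
  unfold blockWeight
  positivity

theorem le_blockWeight_log {l : ℕ} (hl : 1 ≤ l) :
    1 / (3 * (l : ℝ)) ≤ blockWeight (Nat.log 4 l) := by
  have h1 : 4 ^ Nat.log 4 l ≤ l := Nat.pow_log_le_self 4 (by omega)
  have h2 : (4 : ℝ) ^ Nat.log 4 l ≤ l := by exact_mod_cast h1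
  rw [blockWeight]
  apply one_div_le_one_div_of_le (by positivity)
  linarith

theorem blockWeight_log_le {l : ℕ} (hl : 1 ≤ l) :
    blockWeight (Nat.log 4 l) ≤ 4 / (3 * (l : ℝ)) := by
  have h1 : l < 4 ^ (Nat.log 4 l + 1) := Nat.lt_pow_succ_log_self (by norm_num) l
  have h2 : (l : ℝ) < 4 ^ (Nat.log 4 l + 1) := by exact_mod_cast h1
  have hl0 : (0 : ℝ) < l := by exact_mod_cast hl
  rw [blockWeight, div_le_div_iff₀ (by positivity) (by positivity)]
  rw [pow_succ] at h2
  linarith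

/-- The weights `blockWeight (Nat.log 4 l) ≈ 1 / l` are stable under summation against an inverse
square of the distance. -/
theorem sum_blockWeight_div_sub_sq_le {N k : ℕ} (hk : 1 ≤ k) :
    ∑ l ∈ (Finset.Icc 1 N).erase k, blockWeight (Nat.log 4 l) / (1000 * ((k : ℝ) - l) ^ 2) ≤
      28 / 1000 * blockWeight (Nat.log 4 k) := by
  have hk0 : (0 : ℝ) < k := by exact_mod_cast hk
  have hpt : ∀ l ∈ (Finset.Icc 1 N).erase k,
      blockWeight (Nat.log 4 l) / (1000 * ((k : ℝ) - l) ^ 2) ≤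
      4 / (3000 * k) * (3 / 2 * (1 / ((k : ℝ) - l) ^ 2) + 1 / 2 * (1 / (l : ℝ) ^ 2)) := by
    intro l hl
    obtain ⟨hlk, hl1⟩ := Finset.mem_erase.1 hl
    have hl1 := (Finset.mem_Icc.1 hl1).1
    have hl0 : (0 : ℝ) < l := by exact_mod_cast hl1
    have hne : (k : ℝ) - l ≠ 0 := sub_ne_zero.2 (by exact_mod_cast hlk.symm)
    have hsq : 0 < ((k : ℝ) - l) ^ 2 := by positivity
    -- with `d = k - l`, write `k / (l * d ^ 2) = 1 / d ^ 2 + 1 / (l * d)` and use AM-GM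
    have h1 : (k : ℝ) / (l * ((k : ℝ) - l) ^ 2) ≤
        3 / 2 * (1 / ((k : ℝ) - l) ^ 2) + 1 / 2 * (1 / (l : ℝ) ^ 2) := by
      have e : 3 / 2 * (1 / ((k : ℝ) - l) ^ 2) + 1 / 2 * (1 / (l : ℝ) ^ 2) -
          (k : ℝ) / (l * ((k : ℝ) - l) ^ 2) = (1 / ((k : ℝ) - l) - 1 / l) ^ 2 / 2 := by
        field_simp
        ring
      have : 0 ≤ (1 / ((k : ℝ) - l) - 1 / l) ^ 2 / 2 := by positivity
      linarith
    calc blockWeight (Nat.log 4 l) / (1000 * ((k : ℝ) - l) ^ 2)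
        ≤ 4 / (3 * (l : ℝ)) / (1000 * ((k : ℝ) - l) ^ 2) :=
          div_le_div_of_nonneg_right (blockWeight_log_le hl1) (by positivity)
      _ = 4 / (3000 * k) * ((k : ℝ) / (l * ((k : ℝ) - l) ^ 2)) := by
          field_simp
          norm_num
      _ ≤ _ := mul_le_mul_of_nonneg_left h1 (by positivity)
  refine (Finset.sum_le_sum hpt).trans ?_
  rw [← Finset.mul_sum, Finset.sum_add_distrib, ← Finset.mul_sum, ← Finset.mul_sum]
  have h2 := sum_one_div_sub_sq_le_four (Finset.notMem_erase k (Finset.Icc 1 N))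
  have h3 : ∑ l ∈ (Finset.Icc 1 N).erase k, 1 / (l : ℝ) ^ 2 ≤ 2 :=
    (Finset.sum_le_sum_of_subset_of_nonneg (Finset.erase_subset _ _)
      fun _ _ _ => by positivity).trans (sum_Icc_one_div_sq_le_two N)
  calc _ ≤ 4 / (3000 * (k : ℝ)) * 7 :=
        mul_le_mul_of_nonneg_left (by linarith) (by positivity)
    _ = 28 / 1000 * (1 / (3 * (k : ℝ))) := by
        field_simp
        norm_num
    _ ≤ _ := mul_le_mul_of_nonneg_left (le_blockWeight_log hk) (by norm_num)

/-- The `j`-th block of indices `4 ^ j ≤ l < 4 ^ (j + 1)`, cut off at `N`. -/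
def block (N j : ℕ) : Finset ℕ := (Finset.Icc 1 N).filter fun l => Nat.log 4 l = j

theorem card_block_mul_blockWeight_le (N j : ℕ) :
    ((block N j).card : ℝ) * blockWeight j ≤ 1 := by
  have hsub : (block N j) ⊆
      Finset.Ico (4 ^ j) (4 ^ (j + 1)) := by
    intro l hl
    obtain ⟨h1, rfl⟩ := Finset.mem_filter.1 hl
    have h1 := (Finset.mem_Icc.1 h1).1
    exact Finset.mem_Ico.2 ⟨Nat.pow_log_le_self 4 (by omega),
      Nat.lt_pow_succ_log_self (by norm_num) l⟩
  have hcard := Finset.card_le_card hsub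
  rw [Nat.card_Ico, pow_succ] at hcard
  have h2 : (block N j).card ≤ 3 * 4 ^ j := by omega
  have h3 : ((block N j).card : ℝ) ≤ 3 * 4 ^ j := by
    exact_mod_cast h2
  rw [blockWeight, mul_one_div, div_le_one (by positivity)]
  exact h3

theorem sum_Ico_blockWeight_le (i J : ℕ) :
    ∑ j ∈ Finset.Ico i J, blockWeight j ≤ 4 / 3 * blockWeight i := by
  rcases le_total J i with h | h
  · rw [Finset.Ico_eq_empty_of_le h, Finset.sum_empty]
    have := blockWeight_pos i
    linarith
  · have : ∑ j ∈ Finset.Ico i J, blockWeight j = 4 / 3 * (blockWeight i - blockWeight J) := by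
      induction J, h using Nat.le_induction with
      | base => simp
      | succ J hJ ih =>
        rw [Finset.sum_Ico_succ_top hJ, ih]
        unfold blockWeight
        rw [pow_succ]
        field_simp
        ring
    linarith [blockWeight_pos J]

/-! ### The building blocks of the test function -/

/-- The `j`-th building block of the test function: a windowed trigonometric polynomial with
coefficients `u l` at the frequencies `-x l`, divided by the number `3 * 4 ^ j` of integers in
the full block. -/
noncomputable def blockPoly (N : ℕ) (u : ℕ → ℂ) (x : ℕ → ℝ) (j : ℕ) (s : ℝ) : ℂ :=
  bump s * (blockWeight j * ∑ l ∈ block N j, u l * unitExp (-(x l * s)))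

theorem continuous_blockPoly (N : ℕ) (u : ℕ → ℂ) (x : ℕ → ℝ) (j : ℕ) :
    Continuous (blockPoly N u x j) := by
  have := continuous_bump
  have := continuous_unitExp
  unfold blockPoly
  fun_prop

theorem norm_sum_unitExp_le_card {S : Finset ℕ} {u : ℕ → ℂ} (hu : ∀ l, ‖u l‖ ≤ 1) (x : ℕ → ℝ)
    (s : ℝ) : ‖∑ l ∈ S, u l * unitExp (-(x l * s))‖ ≤ S.card := by
  refine (norm_sum_le _ _).trans ?_
  calc ∑ l ∈ S, ‖u l * unitExp (-(x l * s))‖ ≤ ∑ _l ∈ S, (1 : ℝ) :=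
        Finset.sum_le_sum fun l _ => by
          rw [norm_mul, norm_unitExp, mul_one]
          exact hu l
    _ = S.card := by simp

theorem norm_blockPoly_le_one {u : ℕ → ℂ} (hu : ∀ l, ‖u l‖ ≤ 1) (N : ℕ) (x : ℕ → ℝ) (j : ℕ)
    (s : ℝ) : ‖blockPoly N u x j s‖ ≤ 1 := by
  have hw := blockWeight_pos j
  rw [blockPoly, norm_mul, norm_mul, Complex.norm_real, Complex.norm_real,
    Real.norm_of_nonneg (bump_nonneg s), Real.norm_of_nonneg hw.le]
  have h1 := norm_sum_unitExp_le_card (S := block N j) hu x s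
  have h2 := card_block_mul_blockWeight_le N j
  have h3 : blockWeight j * ‖∑ l ∈ block N j, u l * unitExp (-(x l * s))‖ ≤ 1 := by nlinarith
  exact mul_le_one₀ (bump_le_one s) (by positivity) h3

theorem norm_bumpTransform_sub_le {N : ℕ} {x : ℕ → ℝ}
    (hx : ∀ l k : ℕ, 1 ≤ l → l < k → k ≤ N → 72 * ((k : ℝ) - l) ≤ x k - x l) {k l : ℕ}
    (hk : k ∈ Finset.Icc 1 N) (hl : l ∈ Finset.Icc 1 N) (hkl : l ≠ k) :
    ‖bumpTransform (x k - x l)‖ ≤ 1 / (1000 * ((k : ℝ) - l) ^ 2) := by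
  rw [Finset.mem_Icc] at hk hl
  rw [← sq_abs ((k : ℝ) - l)]
  rcases lt_or_gt_of_ne hkl with h | h
  · have h1 : (l : ℝ) + 1 ≤ k := by exact_mod_cast h
    have h2 := hx l k hl.1 h hk.2
    have h3 : |(k : ℝ) - l| = k - l := abs_of_pos (by linarith)
    apply norm_bumpTransform_le_of_gap
    · rw [h3]
      linarith
    · rw [h3, abs_of_pos (by linarith)]
      exact h2
  · have h1 : (k : ℝ) + 1 ≤ l := by exact_mod_cast h
    have h2 := hx k l hk.1 h hl.2
    have h3 : |(k : ℝ) - l| = l - k := by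
      rw [abs_sub_comm]
      exact abs_of_pos (by linarith)
    apply norm_bumpTransform_le_of_gap
    · rw [h3]
      linarith
    · rw [h3, abs_sub_comm, abs_of_pos (by linarith)]
      exact h2

/-- The characters are almost orthogonal with respect to the window: the off-diagonal terms of the
square are tiny by the gap hypothesis. -/
theorem integral_bump_mul_norm_sum_sq_le {u : ℕ → ℂ} (hu : ∀ l, ‖u l‖ ≤ 1) {N : ℕ} {x : ℕ → ℝ}
    (hx : ∀ l k : ℕ, 1 ≤ l → l < k → k ≤ N → 72 * ((k : ℝ) - l) ≤ x k - x l) {S : Finset ℕ}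
    (hS : S ⊆ Finset.Icc 1 N) :
    ∫ s in (0 : ℝ)..1, bump s * ‖∑ l ∈ S, u l * unitExp (-(x l * s))‖ ^ 2 ≤
      504 / 1000 * S.card := by
  have := continuous_bump
  have := continuous_unitExp
  have hpt : ∀ s : ℝ, ((bump s * ‖∑ l ∈ S, u l * unitExp (-(x l * s))‖ ^ 2 : ℝ) : ℂ) =
      ∑ k ∈ S, ∑ l ∈ S, (starRingEnd ℂ) (u k) * u l * (bump s * unitExp ((x k - x l) * s)) := by
    intro s
    push_cast
    rw [← Complex.conj_mul', map_sum, Finset.sum_mul_sum, Finset.mul_sum]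
    refine Finset.sum_congr rfl fun k _ => ?_
    rw [Finset.mul_sum]
    refine Finset.sum_congr rfl fun l _ => ?_
    have h : (x k - x l) * s = x k * s + -(x l * s) := by ring
    rw [map_mul, conj_unitExp, neg_neg, h, unitExp_add]
    ring
  have hint : ∫ s in (0 : ℝ)..1, ((bump s * ‖∑ l ∈ S, u l * unitExp (-(x l * s))‖ ^ 2 : ℝ) : ℂ) =
      ∑ k ∈ S, ∑ l ∈ S, (starRingEnd ℂ) (u k) * u l * bumpTransform (x k - x l) := by
    simp only [hpt]
    rw [intervalIntegral.integral_finsetSum]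
    · refine Finset.sum_congr rfl fun k _ => ?_
      rw [intervalIntegral.integral_finsetSum]
      · simp only [intervalIntegral.integral_const_mul, bumpTransform]
      · intro l _
        apply Continuous.intervalIntegrable
        fun_prop
    · intro k _
      apply Continuous.intervalIntegrable
      fun_prop
  have hrow : ∀ k ∈ S, ‖∑ l ∈ S, (starRingEnd ℂ) (u k) * u l * bumpTransform (x k - x l)‖ ≤
      504 / 1000 := by
    intro k hk
    have hterm : ∀ l, ‖(starRingEnd ℂ) (u k) * u l * bumpTransform (x k - x l)‖ ≤
        ‖bumpTransform (x k - x l)‖ := by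
      intro l
      rw [norm_mul, norm_mul, RCLike.norm_conj]
      exact mul_le_of_le_one_left (norm_nonneg _) (mul_le_one₀ (hu k) (norm_nonneg _) (hu l))
    refine (norm_sum_le_of_le _ fun l _ => hterm l).trans ?_
    rw [← Finset.add_sum_erase _ _ hk, sub_self, bumpTransform_zero]
    have h1 : ∑ l ∈ S.erase k, ‖bumpTransform (x k - x l)‖ ≤
        ∑ l ∈ S.erase k, 1 / 1000 * (1 / ((k : ℝ) - l) ^ 2) := by
      refine Finset.sum_le_sum fun l hl => ?_
      obtain ⟨hlk, hl⟩ := Finset.mem_erase.1 hl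
      refine (norm_bumpTransform_sub_le hx (hS hk) (hS hl) hlk).trans (le_of_eq ?_)
      rw [one_div_mul_one_div]
    rw [← Finset.mul_sum] at h1
    have h2 := sum_one_div_sub_sq_le_four (Finset.notMem_erase k S)
    have h3 : ‖(1 / 2 : ℂ)‖ = 1 / 2 := by norm_num
    rw [h3]
    linarith
  rw [intervalIntegral.integral_ofReal] at hint
  refine (Real.le_norm_self _).trans ?_
  rw [← Complex.norm_real, hint]
  refine (norm_sum_le_of_le _ hrow).trans (le_of_eq ?_)
  rw [Finset.sum_const, nsmul_eq_mul, mul_comm]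

theorem integral_norm_blockPoly_sq_le {u : ℕ → ℂ} (hu : ∀ l, ‖u l‖ ≤ 1) {N : ℕ} {x : ℕ → ℝ}
    (hx : ∀ l k : ℕ, 1 ≤ l → l < k → k ≤ N → 72 * ((k : ℝ) - l) ≤ x k - x l) (j : ℕ) :
    ∫ s in (0 : ℝ)..1, ‖blockPoly N u x j s‖ ^ 2 ≤ 504 / 1000 * blockWeight j := by
  have hw := blockWeight_pos j
  have := continuous_bump
  have := continuous_unitExp
  have hle : ∫ s in (0 : ℝ)..1, ‖blockPoly N u x j s‖ ^ 2 ≤ ∫ s in (0 : ℝ)..1,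
      blockWeight j ^ 2 * (bump s * ‖∑ l ∈ block N j, u l * unitExp (-(x l * s))‖ ^ 2) := by
    apply intervalIntegral.integral_mono zero_le_one
    · exact ((continuous_blockPoly N u x j).norm.pow 2).intervalIntegrable _ _
    · apply Continuous.intervalIntegrable
      fun_prop
    · intro s
      dsimp only
      rw [blockPoly, norm_mul, norm_mul, Complex.norm_real, Complex.norm_real,
        Real.norm_of_nonneg (bump_nonneg s), Real.norm_of_nonneg hw.le, mul_pow, mul_pow,
        mul_left_comm]
      have hb : bump s ^ 2 ≤ bump s := by nlinarith [bump_nonneg s, bump_le_one s]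
      gcongr
  refine hle.trans ?_
  rw [intervalIntegral.integral_const_mul]
  have h1 := integral_bump_mul_norm_sum_sq_le hu hx (S := block N j) (Finset.filter_subset _ _)
  have h2 := card_block_mul_blockWeight_le N j
  calc _ ≤ blockWeight j ^ 2 * (504 / 1000 * (block N j).card) :=
        mul_le_mul_of_nonneg_left h1 (by positivity)
    _ = 504 / 1000 * blockWeight j * ((block N j).card * blockWeight j) := by ring
    _ ≤ 504 / 1000 * blockWeight j * 1 := mul_le_mul_of_nonneg_left h2 (by positivity)
    _ = _ := mul_one _

theorem integral_unitExp_mul_blockPoly_mul (N : ℕ) (u : ℕ → ℂ) (x : ℕ → ℝ) (j k : ℕ) {E : ℝ → ℂ}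
    (hE : Continuous E) :
    ∫ s in (0 : ℝ)..1, unitExp (x k * s) * (blockPoly N u x j s * E s) =
      blockWeight j * ∑ l ∈ block N j,
        u l * ∫ s in (0 : ℝ)..1, bump s * unitExp ((x k - x l) * s) * E s := by
  have := continuous_bump
  have := continuous_unitExp
  simp only [← intervalIntegral.integral_const_mul]
  rw [← intervalIntegral.integral_finsetSum, ← intervalIntegral.integral_const_mul]
  · congr 1
    ext s
    have h : ∀ l, unitExp ((x k - x l) * s) = unitExp (x k * s) * unitExp (-(x l * s)) := by
      intro l
      rw [← unitExp_add]
      ring_nf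
    simp only [h, blockPoly, Finset.mul_sum, Finset.sum_mul]
    refine Finset.sum_congr rfl fun l _ => ?_
    ring
  · intro l _
    apply Continuous.intervalIntegrable
    fun_prop

/-- A block of lower frequencies, multiplied by a bounded function with nonnegative
spectrum, is almost orthogonal to a higher frequency. -/
theorem norm_integral_blockPoly_mul_entire_le {u : ℕ → ℂ} (hu : ∀ l, ‖u l‖ ≤ 1) {N : ℕ}
    {x : ℕ → ℝ} (hx : ∀ l k : ℕ, 1 ≤ l → l < k → k ≤ N → 72 * ((k : ℝ) - l) ≤ x k - x l)
    {G : ℂ → ℂ} (hG : Differentiable ℂ G) (hb : ∀ z, ‖z‖ = 1 → ‖G z‖ ≤ 1) {j k : ℕ}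
    (hk : k ∈ Finset.Icc 1 N) (hj : j < Nat.log 4 k) :
    ‖∫ s in (0 : ℝ)..1, unitExp (x k * s) * (blockPoly N u x j s * G (unitExp s))‖ ≤
      ∑ l ∈ (block N j).erase k, blockWeight (Nat.log 4 l) / (1000 * ((k : ℝ) - l) ^ 2) := by
  rw [integral_unitExp_mul_blockPoly_mul _ _ _ _ _ (E := fun s => G (unitExp s))
    (hG.continuous.comp continuous_unitExp), Finset.mul_sum]
  have hkb : k ∉ block N j := by
    intro h
    exact hj.ne' (Finset.mem_filter.1 h).2
  rw [Finset.erase_eq_of_notMem hkb]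
  refine norm_sum_le_of_le _ fun l hl => ?_
  obtain ⟨hlN, hlj⟩ := Finset.mem_filter.1 hl
  have hlk : l < k := by
    by_contra! h
    have := Nat.log_mono_right (b := 4) h
    omega
  have h1 : (l : ℝ) + 1 ≤ k := by exact_mod_cast hlk
  have h2 := norm_integral_bump_mul_entire_le_of_gap hG hb (d := (k : ℝ) - l) (by linarith)
    (hx l k (Finset.mem_Icc.1 hlN).1 hlk (Finset.mem_Icc.1 hk).2)
  have hw := blockWeight_pos j
  rw [norm_mul, norm_mul, Complex.norm_real, Real.norm_of_nonneg hw.le, hlj, div_eq_mul_one_div]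
  apply mul_le_mul_of_nonneg_left _ hw.le
  calc _ ≤ 1 * _ := mul_le_mul_of_nonneg_right (hu l) (norm_nonneg _)
    _ ≤ _ := by rwa [one_mul]

theorem norm_integral_blockPoly_sub_le {u : ℕ → ℂ} (hu : ∀ l, ‖u l‖ ≤ 1) {N : ℕ}
    {x : ℕ → ℝ} (hx : ∀ l k : ℕ, 1 ≤ l → l < k → k ≤ N → 72 * ((k : ℝ) - l) ≤ x k - x l)
    {j k : ℕ} (hk : k ∈ Finset.Icc 1 N) :
    ‖(∫ s in (0 : ℝ)..1, unitExp (x k * s) * blockPoly N u x j s) -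
        (if j = Nat.log 4 k then blockWeight j * u k / 2 else 0)‖ ≤
      ∑ l ∈ (block N j).erase k, blockWeight (Nat.log 4 l) / (1000 * ((k : ℝ) - l) ^ 2) := by
  have h := integral_unitExp_mul_blockPoly_mul N u x j k (E := fun _ => 1) continuous_const
  simp only [mul_one] at h
  have hw := blockWeight_pos j
  have hsplit : (∫ s in (0 : ℝ)..1, unitExp (x k * s) * blockPoly N u x j s) -
      (if j = Nat.log 4 k then blockWeight j * u k / 2 else 0) =
      ∑ l ∈ (block N j).erase k, (blockWeight j : ℂ) * (u l * bumpTransform (x k - x l)) := by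
    rw [h, ← Finset.mul_sum]
    change _ * ∑ l ∈ block N j, u l * bumpTransform (x k - x l) - _ = _
    split_ifs with hj
    · have hkb : k ∈ block N j := Finset.mem_filter.2 ⟨hk, hj.symm⟩
      rw [← Finset.add_sum_erase _ _ hkb, sub_self, bumpTransform_zero]
      ring
    · have hkb : k ∉ block N j := fun h => hj (Finset.mem_filter.1 h).2.symm
      rw [Finset.erase_eq_of_notMem hkb, sub_zero]
  rw [hsplit]
  refine norm_sum_le_of_le _ fun l hl => ?_
  obtain ⟨hlk, hl⟩ := Finset.mem_erase.1 hl
  obtain ⟨hlN, hlj⟩ := Finset.mem_filter.1 hl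
  have h2 := norm_bumpTransform_sub_le hx hk hlN hlk
  rw [norm_mul, norm_mul, Complex.norm_real, Real.norm_of_nonneg hw.le, hlj, div_eq_mul_one_div]
  apply mul_le_mul_of_nonneg_left _ hw.le
  calc _ ≤ 1 * _ := mul_le_mul_of_nonneg_right (hu l) (norm_nonneg _)
    _ ≤ _ := by rwa [one_mul]

/-- Minkowski's inequality for a geometrically decaying sequence, by the Cauchy-Schwarz inequality
with weights `2 ^ (-i)`. -/
theorem integral_norm_sum_sq_le {h : ℕ → ℝ → ℂ} (hc : ∀ i, Continuous (h i)) {K : ℝ} (hK : 0 ≤ K)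
    (hh : ∀ i, ∫ s in (0 : ℝ)..1, ‖h i s‖ ^ 2 ≤ K * blockWeight i) (j J : ℕ) :
    ∫ s in (0 : ℝ)..1, ‖∑ i ∈ Finset.Ico (j + 1) J, h i s‖ ^ 2 ≤ K * blockWeight j := by
  have hgeom : ∑ i ∈ Finset.Ico (j + 1) J, (1 / 2 : ℝ) ^ i ≤ (1 / 2) ^ j := by
    rcases le_total J (j + 1) with hJ | hJ
    · rw [Finset.Ico_eq_empty_of_le hJ, Finset.sum_empty]
      positivity
    · have : ∑ i ∈ Finset.Ico (j + 1) J, (1 / 2 : ℝ) ^ i = (1 / 2) ^ j - 2 * (1 / 2) ^ J := by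
        induction J, hJ using Nat.le_induction with
        | base => rw [Finset.Ico_self, Finset.sum_empty, pow_succ]; ring
        | succ J hJ ih => rw [Finset.sum_Ico_succ_top hJ, ih, pow_succ]; ring
      have h2 : (0 : ℝ) ≤ 2 * (1 / 2) ^ J := by positivity
      linarith
  have hpt : ∀ s, ‖∑ i ∈ Finset.Ico (j + 1) J, h i s‖ ^ 2 ≤
      (1 / 2) ^ j * ∑ i ∈ Finset.Ico (j + 1) J, 2 ^ i * ‖h i s‖ ^ 2 := by
    intro s
    calc ‖∑ i ∈ Finset.Ico (j + 1) J, h i s‖ ^ 2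
        ≤ (∑ i ∈ Finset.Ico (j + 1) J, ‖h i s‖) ^ 2 :=
          pow_le_pow_left₀ (norm_nonneg _) (norm_sum_le _ _) 2
      _ ≤ (∑ i ∈ Finset.Ico (j + 1) J, (1 / 2 : ℝ) ^ i) *
            ∑ i ∈ Finset.Ico (j + 1) J, 2 ^ i * ‖h i s‖ ^ 2 := by
          apply Finset.sum_sq_le_sum_mul_sum_of_sq_le_mul
          · exact fun i _ => by positivity
          · exact fun i _ => by positivity
          · intro i _
            rw [← mul_assoc, ← mul_pow]
            norm_num
      _ ≤ _ := mul_le_mul_of_nonneg_right hgeom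
          (Finset.sum_nonneg fun i _ => by positivity)
  have hle : ∫ s in (0 : ℝ)..1, ‖∑ i ∈ Finset.Ico (j + 1) J, h i s‖ ^ 2 ≤
      ∫ s in (0 : ℝ)..1, (1 / 2) ^ j * ∑ i ∈ Finset.Ico (j + 1) J, 2 ^ i * ‖h i s‖ ^ 2 := by
    apply intervalIntegral.integral_mono zero_le_one
    · exact ((continuous_finsetSum _ fun i _ => hc i).norm.pow 2).intervalIntegrable _ _
    · exact ((continuous_finsetSum _ fun i _ =>
        ((hc i).norm.pow 2).const_mul _).const_mul _).intervalIntegrable _ _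
    · exact hpt
  refine hle.trans ?_
  have hint : ∀ i ∈ Finset.Ico (j + 1) J, IntervalIntegrable (fun s => 2 ^ i * ‖h i s‖ ^ 2)
      MeasureTheory.volume 0 1 :=
    fun i _ => (((hc i).norm.pow 2).const_mul _).intervalIntegrable _ _
  rw [intervalIntegral.integral_const_mul, intervalIntegral.integral_finsetSum hint]
  simp only [intervalIntegral.integral_const_mul]
  have hbw : ∀ i, (2 : ℝ) ^ i * blockWeight i = 1 / 3 * (1 / 2) ^ i := by
    intro i
    have : (4 : ℝ) ^ i = 2 ^ i * 2 ^ i := by rw [← mul_pow]; norm_num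
    rw [blockWeight, this, one_div_pow]
    field_simp
  have hsum : ∑ i ∈ Finset.Ico (j + 1) J, (2 : ℝ) ^ i * ∫ s in (0 : ℝ)..1, ‖h i s‖ ^ 2 ≤
      K / 3 * (1 / 2) ^ j := by
    calc _ ≤ ∑ i ∈ Finset.Ico (j + 1) J, K / 3 * (1 / 2 : ℝ) ^ i := by
          refine Finset.sum_le_sum fun i _ => ?_
          calc _ ≤ (2 : ℝ) ^ i * (K * blockWeight i) :=
                mul_le_mul_of_nonneg_left (hh i) (by positivity)
            _ = K * (2 ^ i * blockWeight i) := by ring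
            _ = _ := by rw [hbw]; ring
      _ ≤ _ := by
          rw [← Finset.mul_sum]
          exact mul_le_mul_of_nonneg_left hgeom (by positivity)
  calc _ ≤ (1 / 2 : ℝ) ^ j * (K / 3 * (1 / 2) ^ j) :=
        mul_le_mul_of_nonneg_left hsum (by positivity)
    _ = K * blockWeight j := by
        have : (4 : ℝ) ^ j = 2 ^ j * 2 ^ j := by rw [← mul_pow]; norm_num
        rw [blockWeight, this, one_div_pow]
        field_simp

/-- Replacing the damping factor `exp (-H / 5)` by `1` costs little in mean. -/
theorem norm_integral_mul_exp_sub_one_le {e f H : ℝ → ℂ} (he : ∀ s, ‖e s‖ = 1)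
    (hf : Continuous f) (hH : Continuous H)
    (hre : ∀ s ∈ Set.Icc (0 : ℝ) 1, 0 ≤ (H s).re) :
    ‖∫ s in (0 : ℝ)..1, e s * (f s * (Complex.exp (-(H s / 5)) - 1))‖ ≤
      1 / 10 * ((∫ s in (0 : ℝ)..1, ‖f s‖ ^ 2) + ∫ s in (0 : ℝ)..1, ‖H s‖ ^ 2) := by
  have hif : IntervalIntegrable (fun s => ‖f s‖ ^ 2) MeasureTheory.volume 0 1 :=
    (hf.norm.pow 2).intervalIntegrable _ _
  have hiH : IntervalIntegrable (fun s => ‖H s‖ ^ 2) MeasureTheory.volume 0 1 :=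
    (hH.norm.pow 2).intervalIntegrable _ _
  rw [← intervalIntegral.integral_add hif hiH, ← intervalIntegral.integral_const_mul]
  apply intervalIntegral.norm_integral_le_of_norm_le zero_le_one
  · refine Filter.Eventually.of_forall fun s hs => ?_
    have hs' : s ∈ Set.Icc (0 : ℝ) 1 := ⟨hs.1.le, hs.2⟩
    have h1 : ‖Complex.exp (-(H s / 5)) - 1‖ ≤ ‖H s‖ / 5 := by
      refine (norm_exp_sub_one_le_of_re_nonpos ?_).trans (le_of_eq ?_)
      · have : (-(H s / 5)).re = -((H s).re / 5) := by simp
        rw [this]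
        linarith [hre s hs']
      · rw [norm_neg, norm_div]
        norm_num
    rw [norm_mul, norm_mul, he, one_mul]
    calc ‖f s‖ * ‖Complex.exp (-(H s / 5)) - 1‖ ≤ ‖f s‖ * (‖H s‖ / 5) :=
          mul_le_mul_of_nonneg_left h1 (norm_nonneg _)
      _ ≤ _ := by nlinarith [sq_nonneg (‖f s‖ - ‖H s‖)]
  · exact (hif.add hiH).const_mul _

/-! ### The nonharmonic Littlewood inequality -/

/-- The entire functions whose real parts majorize the blocks. -/
theorem exists_entire_majorants {u : ℕ → ℂ} (hu : ∀ l, ‖u l‖ ≤ 1) {N : ℕ} {x : ℕ → ℝ}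
    (hx : ∀ l k : ℕ, 1 ≤ l → l < k → k ≤ N → 72 * ((k : ℝ) - l) ≤ x k - x l) :
    ∃ h : ℕ → ℂ → ℂ, ∀ j, Differentiable ℂ (h j) ∧
      (∀ s ∈ Set.Icc (0 : ℝ) 1, ‖blockPoly N u x j s‖ ≤ (h j (unitExp s)).re) ∧
      ∫ s in (0 : ℝ)..1, ‖h j (unitExp s)‖ ^ 2 ≤ 13 / 10 * blockWeight j := by
  have hex : ∀ j, ∃ h : ℂ → ℂ, Differentiable ℂ h ∧
      (∀ s ∈ Set.Icc (0 : ℝ) 1, ‖blockPoly N u x j s‖ ≤ (h (unitExp s)).re) ∧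
      ∫ s in (0 : ℝ)..1, ‖h (unitExp s)‖ ^ 2 ≤ 13 / 10 * blockWeight j := by
    intro j
    have hw := blockWeight_pos j
    obtain ⟨h, hd, hre, hsq⟩ := exists_entire_re_ge (g := fun s => ‖blockPoly N u x j s‖)
      (continuous_blockPoly N u x j).norm.continuousOn
      (by simp [blockPoly, bump_zero, bump_one]) (fun _ _ => norm_nonneg _)
      (fun s _ => norm_blockPoly_le_one hu N x j s) (η := blockWeight j / 5) (by positivity)
    refine ⟨h, hd, hre, hsq.trans ?_⟩
    linarith [integral_norm_blockPoly_sq_le hu hx j]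
  choose h hh using hex
  exact ⟨h, hh⟩

/-- Every point of the unit circle is of the form `exp (2πis)` with `0 ≤ s ≤ 1`. -/
theorem exists_unitExp_eq {z : ℂ} (hz : ‖z‖ = 1) : ∃ s ∈ Set.Icc (0 : ℝ) 1, unitExp s = z := by
  have hpi := Real.pi_pos
  have hz' : unitExp (Complex.arg z / (2 * Real.pi)) = z := by
    have h := Complex.norm_mul_exp_arg_mul_I z
    rw [hz, Complex.ofReal_one, one_mul] at h
    rw [unitExp]
    convert h using 2
    push_cast
    have : (Real.pi : ℂ) ≠ 0 := by exact_mod_cast hpi.ne'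
    field_simp
  have h1 := Complex.neg_pi_lt_arg z
  have h2 := Complex.arg_le_pi z
  rcases le_or_gt 0 (Complex.arg z) with h | h
  · refine ⟨_, ⟨by positivity, ?_⟩, hz'⟩
    rw [div_le_one (by positivity)]
    linarith
  · refine ⟨Complex.arg z / (2 * Real.pi) + 1, ⟨?_, ?_⟩, ?_⟩
    · have : -1 ≤ Complex.arg z / (2 * Real.pi) := by
        rw [le_div_iff₀ (by positivity)]
        linarith
      linarith
    · have : Complex.arg z / (2 * Real.pi) ≤ 0 :=
        div_nonpos_of_nonpos_of_nonneg h.le (by positivity)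
      linarith
    · rw [unitExp_add, hz']
      simp [unitExp]

/-- The contribution of one block to a coefficient of the test function. For the blocks below that
of `k` the damping factor is handled through its spectrum, for the others through its size. -/
theorem norm_integral_damped_blockPoly_sub_le {u : ℕ → ℂ} (hu : ∀ l, ‖u l‖ ≤ 1) {N : ℕ}
    {x : ℕ → ℝ} (hx : ∀ l k : ℕ, 1 ≤ l → l < k → k ≤ N → 72 * ((k : ℝ) - l) ≤ x k - x l)
    {H : ℂ → ℂ} (hH : Differentiable ℂ H)
    (hre : ∀ s ∈ Set.Icc (0 : ℝ) 1, 0 ≤ (H (unitExp s)).re) {j k : ℕ}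
    (hsq : ∫ s in (0 : ℝ)..1, ‖H (unitExp s)‖ ^ 2 ≤ 13 / 10 * blockWeight j)
    (hk : k ∈ Finset.Icc 1 N) :
    ‖(∫ s in (0 : ℝ)..1, unitExp (x k * s) *
        (blockPoly N u x j s * Complex.exp (-(H (unitExp s) / 5)))) -
        (if j = Nat.log 4 k then blockWeight j * u k / 2 else 0)‖ ≤
      (∑ l ∈ (block N j).erase k, blockWeight (Nat.log 4 l) / (1000 * ((k : ℝ) - l) ^ 2)) +
        (if Nat.log 4 k ≤ j then 181 / 1000 * blockWeight j else 0) := by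
  rcases lt_or_ge j (Nat.log 4 k) with hj | hj
  · rw [if_neg hj.ne, if_neg (not_le.2 hj), sub_zero, add_zero]
    refine norm_integral_blockPoly_mul_entire_le hu hx
      (G := fun z => Complex.exp (-(H z / 5))) (by fun_prop) (fun z hz => ?_) hk hj
    obtain ⟨s, hs, rfl⟩ := exists_unitExp_eq hz
    rw [Complex.norm_exp, Real.exp_le_one_iff]
    have : (-(H (unitExp s) / 5)).re = -((H (unitExp s)).re / 5) := by simp
    rw [this]
    linarith [hre s hs]
  · rw [if_pos hj]
    have hcf := continuous_blockPoly N u x j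
    have hcH : Continuous fun s => H (unitExp s) := hH.continuous.comp continuous_unitExp
    have hce : Continuous fun s => unitExp (x k * s) :=
      continuous_unitExp.comp (continuous_const.mul continuous_id)
    have h1 := norm_integral_blockPoly_sub_le hu hx (j := j) hk
    have h2 := norm_integral_mul_exp_sub_one_le (e := fun s => unitExp (x k * s))
      (fun s => norm_unitExp _) hcf hcH hre
    have h3 := integral_norm_blockPoly_sq_le hu hx j
    have hsplit : ∫ s in (0 : ℝ)..1, unitExp (x k * s) *
        (blockPoly N u x j s * Complex.exp (-(H (unitExp s) / 5))) =
        (∫ s in (0 : ℝ)..1, unitExp (x k * s) * blockPoly N u x j s) +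
        ∫ s in (0 : ℝ)..1, unitExp (x k * s) *
          (blockPoly N u x j s * (Complex.exp (-(H (unitExp s) / 5)) - 1)) := by
      rw [← intervalIntegral.integral_add]
      · congr 1
        ext s
        ring
      · exact (hce.mul hcf).intervalIntegrable _ _
      · exact (hce.mul (hcf.mul ((Complex.continuous_exp.comp (hcH.div_const 5).neg).sub
          continuous_const))).intervalIntegrable _ _
    rw [hsplit, add_sub_right_comm]
    refine (norm_add_le _ _).trans (add_le_add h1 (h2.trans ?_))
    have hw := blockWeight_pos j
    -- `(504 / 1000 + 13 / 10) / 10 < 181 / 1000`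
    linarith

/-- The coefficient of the test function at the `k`-th frequency is `u k / 2` times the weight of its
block, up to `27 / 100` of that weight. -/
theorem norm_sum_integral_damped_blockPoly_sub_le {u : ℕ → ℂ} (hu : ∀ l, ‖u l‖ ≤ 1) {N : ℕ}
    {x : ℕ → ℝ} (hx : ∀ l k : ℕ, 1 ≤ l → l < k → k ≤ N → 72 * ((k : ℝ) - l) ≤ x k - x l)
    {h : ℕ → ℂ → ℂ} (hd : ∀ j, Differentiable ℂ (h j))
    (hre : ∀ j, ∀ s ∈ Set.Icc (0 : ℝ) 1, ‖blockPoly N u x j s‖ ≤ (h j (unitExp s)).re)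
    (hsq : ∀ j, ∫ s in (0 : ℝ)..1, ‖h j (unitExp s)‖ ^ 2 ≤ 13 / 10 * blockWeight j)
    {J k : ℕ} (hJ : Nat.log 4 N < J) (hk : k ∈ Finset.Icc 1 N) :
    ‖(∑ j ∈ Finset.range J, ∫ s in (0 : ℝ)..1, unitExp (x k * s) * (blockPoly N u x j s *
        Complex.exp (-((∑ i ∈ Finset.Ico (j + 1) J, h i (unitExp s)) / 5)))) -
        blockWeight (Nat.log 4 k) * u k / 2‖ ≤ 27 / 100 * blockWeight (Nat.log 4 k) := by
  have hkJ : Nat.log 4 k < J := (Nat.log_mono_right (Finset.mem_Icc.1 hk).2).trans_lt hJ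
  have hterm : ∀ j ∈ Finset.range J, _ := fun j _ =>
    norm_integral_damped_blockPoly_sub_le hu hx
      (H := fun z => ∑ i ∈ Finset.Ico (j + 1) J, h i z)
      (Differentiable.fun_sum fun i _ => hd i)
      (fun s hs => by
        rw [Complex.re_sum]
        exact Finset.sum_nonneg fun i _ => (norm_nonneg _).trans (hre i s hs))
      (integral_norm_sum_sq_le (h := fun i s => h i (unitExp s))
        (fun i => (hd i).continuous.comp continuous_unitExp) (by norm_num) hsq j J) hk
  have hsum := norm_sum_le_of_le _ hterm
  rw [Finset.sum_sub_distrib, Finset.sum_add_distrib, Finset.sum_ite_eq',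
    if_pos (Finset.mem_range.2 hkJ)] at hsum
  refine hsum.trans ?_
  have h1 : ∑ j ∈ Finset.range J, ∑ l ∈ (block N j).erase k,
      blockWeight (Nat.log 4 l) / (1000 * ((k : ℝ) - l) ^ 2) =
      ∑ l ∈ (Finset.Icc 1 N).erase k,
        blockWeight (Nat.log 4 l) / (1000 * ((k : ℝ) - l) ^ 2) := by
    rw [← Finset.sum_fiberwise_of_maps_to (s := (Finset.Icc 1 N).erase k) (t := Finset.range J)
      (g := fun l => Nat.log 4 l)]
    · refine Finset.sum_congr rfl fun j _ => Finset.sum_congr ?_ fun _ _ => rfl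
      rw [block, Finset.filter_erase]
    · intro l hl
      have hl := (Finset.mem_Icc.1 (Finset.mem_of_mem_erase hl)).2
      exact Finset.mem_range.2 ((Nat.log_mono_right hl).trans_lt hJ)
  have h2 : ∑ j ∈ Finset.range J, (if Nat.log 4 k ≤ j then 181 / 1000 * blockWeight j else 0) =
      181 / 1000 * ∑ j ∈ Finset.Ico (Nat.log 4 k) J, blockWeight j := by
    rw [← Finset.sum_filter, Finset.mul_sum]
    refine Finset.sum_congr ?_ fun _ _ => rfl
    ext j
    simp only [Finset.mem_filter, Finset.mem_range, Finset.mem_Ico]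
    tauto
  rw [h1, h2]
  have h3 := sum_blockWeight_div_sub_sq_le (N := N) (Finset.mem_Icc.1 hk).1
  have h4 := sum_Ico_blockWeight_le (Nat.log 4 k) J
  have hw := blockWeight_pos (Nat.log 4 k)
  -- `28 / 1000 + (4 / 3) * (181 / 1000) < 27 / 100`
  linarith

/-- The nonharmonic Littlewood inequality on an interval of length one, for frequencies separated
by gaps of at least `72`. -/
theorem sum_norm_div_le_integral_norm (N : ℕ) (b : ℕ → ℂ) (x : ℕ → ℝ)
    (hx : ∀ l k : ℕ, 1 ≤ l → l < k → k ≤ N → 72 * ((k : ℝ) - l) ≤ x k - x l) :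
    1 / 120 * ∑ k ∈ Finset.Icc 1 N, ‖b k‖ / (k : ℝ) ≤
      ∫ s in (0 : ℝ)..1, ‖∑ k ∈ Finset.Icc 1 N, b k * unitExp (x k * s)‖ := by
  -- `u k` is the phase conjugate to that of `b k`, and zero if `b k` vanishes
  set u : ℕ → ℂ := fun k => (starRingEnd ℂ) (b k) / ‖b k‖ with hudef
  have hu : ∀ k, ‖u k‖ ≤ 1 := by
    intro k
    simp only [hudef, norm_div, RCLike.norm_conj, Complex.norm_real, norm_norm]
    exact div_self_le_one _
  have hbu : ∀ k, b k * u k = ‖b k‖ := by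
    intro k
    simp only [hudef]
    rw [← mul_div_assoc, Complex.mul_conj']
    rcases eq_or_ne (b k) 0 with h | h
    · simp [h]
    · have : (‖b k‖ : ℂ) ≠ 0 := by exact_mod_cast norm_ne_zero_iff.2 h
      field_simp
  obtain ⟨h, hh⟩ := exists_entire_majorants hu hx
  set J := Nat.log 4 N + 1 with hJ
  set F : ℝ → ℂ := fun s => ∑ j ∈ Finset.range J, blockPoly N u x j s *
    Complex.exp (-((∑ i ∈ Finset.Ico (j + 1) J, h i (unitExp s)) / 5)) with hF
  have hch : ∀ i, Continuous fun s => h i (unitExp s) :=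
    fun i => (hh i).1.continuous.comp continuous_unitExp
  have hcp := continuous_blockPoly N u x
  have hce := continuous_unitExp
  have hcterm : ∀ j, Continuous fun s => blockPoly N u x j s *
      Complex.exp (-((∑ i ∈ Finset.Ico (j + 1) J, h i (unitExp s)) / 5)) := by
    intro j
    exact (hcp j).mul (Complex.continuous_exp.comp
      ((continuous_finsetSum _ fun i _ => hch i).div_const 5).neg)
  have hcF : Continuous F := by
    rw [hF]
    fun_prop
  have hF6 : ∀ s ∈ Set.Icc (0 : ℝ) 1, ‖F s‖ ≤ 6 := fun s hs =>
    norm_sum_mul_exp_le_six (f := fun j => blockPoly N u x j s) (h := fun j => h j (unitExp s))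
      (fun j => norm_blockPoly_le_one hu N x j s) (fun j => (hh j).2.1 s hs) J
  have hupper : ‖∫ s in (0 : ℝ)..1, (∑ k ∈ Finset.Icc 1 N, b k * unitExp (x k * s)) * F s‖ ≤
      6 * ∫ s in (0 : ℝ)..1, ‖∑ k ∈ Finset.Icc 1 N, b k * unitExp (x k * s)‖ := by
    rw [← intervalIntegral.integral_const_mul]
    apply intervalIntegral.norm_integral_le_of_norm_le zero_le_one
    · refine Filter.Eventually.of_forall fun s hs => ?_
      rw [norm_mul, mul_comm]
      exact mul_le_mul_of_nonneg_right (hF6 s ⟨hs.1.le, hs.2⟩) (norm_nonneg _)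
    · apply Continuous.intervalIntegrable
      fun_prop
  have hexpand : ∫ s in (0 : ℝ)..1, (∑ k ∈ Finset.Icc 1 N, b k * unitExp (x k * s)) * F s =
      ∑ k ∈ Finset.Icc 1 N, b k * ∑ j ∈ Finset.range J, ∫ s in (0 : ℝ)..1,
        unitExp (x k * s) * (blockPoly N u x j s *
          Complex.exp (-((∑ i ∈ Finset.Ico (j + 1) J, h i (unitExp s)) / 5))) := by
    have h1 : ∀ s, (∑ k ∈ Finset.Icc 1 N, b k * unitExp (x k * s)) * F s =
        ∑ k ∈ Finset.Icc 1 N, b k * ∑ j ∈ Finset.range J,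
          unitExp (x k * s) * (blockPoly N u x j s *
            Complex.exp (-((∑ i ∈ Finset.Ico (j + 1) J, h i (unitExp s)) / 5))) := by
      intro s
      rw [Finset.sum_mul]
      refine Finset.sum_congr rfl fun k _ => ?_
      rw [← Finset.mul_sum, mul_assoc]
    simp only [h1]
    rw [intervalIntegral.integral_finsetSum]
    · refine Finset.sum_congr rfl fun k _ => ?_
      rw [intervalIntegral.integral_const_mul, intervalIntegral.integral_finsetSum]
      intro j _
      apply Continuous.intervalIntegrable
      fun_prop
    · intro k _
      apply Continuous.intervalIntegrable
      fun_prop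
  have hlower : ∀ k ∈ Finset.Icc 1 N, 6 * (1 / 120 * (‖b k‖ / (k : ℝ))) ≤
      (b k * ∑ j ∈ Finset.range J, ∫ s in (0 : ℝ)..1,
        unitExp (x k * s) * (blockPoly N u x j s *
          Complex.exp (-((∑ i ∈ Finset.Ico (j + 1) J, h i (unitExp s)) / 5)))).re := by
    intro k hk
    have hc := norm_sum_integral_damped_blockPoly_sub_le hu hx (fun j => (hh j).1)
      (fun j => (hh j).2.1) (fun j => (hh j).2.2) (lt_add_one (Nat.log 4 N)) hk
    rw [← hJ] at hc
    set c := ∑ j ∈ Finset.range J, ∫ s in (0 : ℝ)..1,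
        unitExp (x k * s) * (blockPoly N u x j s *
          Complex.exp (-((∑ i ∈ Finset.Ico (j + 1) J, h i (unitExp s)) / 5)))
    set w := blockWeight (Nat.log 4 k) with hw
    have h1 : b k * c = ((w * ‖b k‖ / 2 : ℝ) : ℂ) + b k * (c - w * u k / 2) := by
      push_cast
      rw [← hbu]
      ring
    have h2 : |(b k * (c - w * u k / 2)).re| ≤ ‖b k‖ * (27 / 100 * w) := by
      refine (Complex.abs_re_le_norm _).trans ?_
      rw [norm_mul]
      exact mul_le_mul_of_nonneg_left hc (norm_nonneg _)
    have h3 : 1 / (3 * (k : ℝ)) ≤ w := le_blockWeight_log (Finset.mem_Icc.1 hk).1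
    have h4 := mul_le_mul_of_nonneg_left h3 (norm_nonneg (b k))
    have h5 : ‖b k‖ / (k : ℝ) = 3 * (‖b k‖ * (1 / (3 * (k : ℝ)))) := by
      have : (k : ℝ) ≠ 0 := by
        have := (Finset.mem_Icc.1 hk).1
        positivity
      field_simp
    rw [h1, Complex.add_re, Complex.ofReal_re, h5]
    have h6 := (abs_le.1 h2).1
    have h7 : 0 ≤ ‖b k‖ * w := mul_nonneg (norm_nonneg _) (blockWeight_pos _).le
    -- `6 * 3 / 120 ≤ 1 / 2 - 27 / 100`
    linarith
  have htotal := Finset.sum_le_sum hlower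
  rw [← Finset.mul_sum, ← Finset.mul_sum, ← Complex.re_sum, ← hexpand] at htotal
  have := htotal.trans ((Complex.re_le_norm _).trans hupper)
  linarith

/-! ### The length of a curve -/

theorem eVariationOn_Icc_le_integral_norm_deriv {γ γ' : ℝ → ℂ} (hd : ∀ t, HasDerivAt γ (γ' t) t)
    (hc : Continuous γ') (a b : ℝ) :
    eVariationOn γ (Set.Icc a b) ≤ ENNReal.ofReal (∫ t in a..b, ‖γ' t‖) := by
  have hi : ∀ p q, IntervalIntegrable (fun t => ‖γ' t‖) MeasureTheory.volume p q :=
    fun p q => hc.norm.intervalIntegrable p q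
  refine iSup_le fun ⟨n, u, hu, hmem⟩ => ?_
  have hstep : ∀ i ∈ Finset.range n, edist (γ (u (i + 1))) (γ (u i)) ≤
      ENNReal.ofReal (∫ t in u i..u (i + 1), ‖γ' t‖) := by
    intro i _
    rw [edist_dist, dist_eq_norm]
    apply ENNReal.ofReal_le_ofReal
    rw [← intervalIntegral.integral_eq_sub_of_hasDerivAt (fun t _ => hd t)
      (hc.intervalIntegrable _ _)]
    exact intervalIntegral.norm_integral_le_integral_norm (hu i.le_succ)
  refine (Finset.sum_le_sum hstep).trans ?_
  rw [← ENNReal.ofReal_sum_of_nonneg]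
  · rw [intervalIntegral.sum_integral_adjacent_intervals fun _ _ => hi _ _]
    apply ENNReal.ofReal_le_ofReal
    exact intervalIntegral.integral_mono_interval (hmem 0).1 (hu n.zero_le) (hmem n).2
      (Filter.Eventually.of_forall fun t => norm_nonneg _) (hi _ _)
  · intro i _
    exact intervalIntegral.integral_nonneg (hu i.le_succ) fun _ _ => norm_nonneg _

/-- On an interval where the derivative oscillates by at most `η`, the chord is almost as long as
the arc. -/
theorem integral_norm_deriv_le_norm_sub_add {γ γ' : ℝ → ℂ} (hd : ∀ t, HasDerivAt γ (γ' t) t)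
    (hc : Continuous γ') {p q η : ℝ} (hpq : p ≤ q)
    (hη : ∀ t ∈ Set.Icc p q, ‖γ' t - γ' p‖ ≤ η) :
    ∫ t in p..q, ‖γ' t‖ ≤ ‖γ q - γ p‖ + 2 * η * (q - p) := by
  have h1 : ∫ t in p..q, ‖γ' t‖ ≤ ∫ _ in p..q, (‖γ' p‖ + η) := by
    apply intervalIntegral.integral_mono_on hpq (hc.norm.intervalIntegrable _ _) (by simp)
    intro t ht
    have := norm_le_norm_add_norm_sub' (γ' t) (γ' p)
    linarith [hη t ht]
  have h2 : ‖∫ t in p..q, (γ' t - γ' p)‖ ≤ η * |q - p| := by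
    apply intervalIntegral.norm_integral_le_of_norm_le_const
    intro t ht
    rw [Set.uIoc_of_le hpq] at ht
    exact hη t ⟨ht.1.le, ht.2⟩
  rw [intervalIntegral.integral_sub (hc.intervalIntegrable _ _) (by simp),
    intervalIntegral.integral_eq_sub_of_hasDerivAt (fun t _ => hd t) (hc.intervalIntegrable _ _),
    intervalIntegral.integral_const, abs_of_nonneg (sub_nonneg.2 hpq)] at h2
  rw [intervalIntegral.integral_const, smul_eq_mul] at h1
  have h3 : ‖(q - p) • γ' p‖ = (q - p) * ‖γ' p‖ := by
    rw [norm_smul, Real.norm_of_nonneg (sub_nonneg.2 hpq)]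
  have h4 : ‖(q - p) • γ' p‖ ≤ ‖γ q - γ p‖ + ‖γ q - γ p - (q - p) • γ' p‖ := by
    have := norm_sub_le (γ q - γ p) (γ q - γ p - (q - p) • γ' p)
    simpa using this
  nlinarith

/-- The length of a continuously differentiable curve is the integral of its speed. -/
theorem eVariationOn_Icc_eq_integral_norm_deriv {γ γ' : ℝ → ℂ} (hd : ∀ t, HasDerivAt γ (γ' t) t)
    (hc : Continuous γ') {a b : ℝ} (hab : a < b) :
    eVariationOn γ (Set.Icc a b) = ENNReal.ofReal (∫ t in a..b, ‖γ' t‖) := by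
  have hle := eVariationOn_Icc_le_integral_norm_deriv hd hc a b
  refine le_antisymm hle ?_
  have htop : eVariationOn γ (Set.Icc a b) ≠ ⊤ := ne_top_of_le_ne_top ENNReal.ofReal_ne_top hle
  rw [ENNReal.ofReal_le_iff_le_toReal htop]
  refine le_of_forall_pos_le_add fun ε hε => ?_
  have hba : 0 < b - a := sub_pos.2 hab
  set η : ℝ := ε / (2 * (b - a)) with hη
  have hη0 : 0 < η := by positivity
  obtain ⟨δ, hδ0, hδ⟩ := Metric.uniformContinuousOn_iff.1
    (isCompact_Icc.uniformContinuousOn_of_continuous (hc.continuousOn (s := Set.Icc a b))) η hη0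
  obtain ⟨n, hn⟩ := exists_nat_gt ((b - a) / δ)
  have hn0 : (0 : ℝ) < n := lt_of_le_of_lt (by positivity) hn
  -- the uniform partition into `n` intervals, frozen at `b` after `n` steps
  set u : ℕ → ℝ := fun i => min b (a + i * ((b - a) / n)) with hu
  have hmono : Monotone u := by
    intro i j hij
    apply min_le_min_left
    have : (i : ℝ) ≤ j := by exact_mod_cast hij
    have hp : 0 ≤ (b - a) / n := by positivity
    nlinarith
  have hmem : ∀ i, u i ∈ Set.Icc a b := fun i =>
    ⟨le_min hab.le (le_add_of_nonneg_right (by positivity)), min_le_left _ _⟩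
  have hu0 : u 0 = a := by simp [hu, hab.le]
  have hun : u n = b := by
    have : a + n * ((b - a) / n) = b := by field_simp; ring
    simp [hu, this]
  have hwidth : ∀ i, u (i + 1) - u i < δ := by
    intro i
    have h1 : (b - a) / n < δ := by
      rw [div_lt_iff₀ hn0]
      rw [div_lt_iff₀ hδ0] at hn
      linarith
    have h2 : u (i + 1) ≤ u i + (b - a) / n := by
      have hp : 0 ≤ (b - a) / n := by positivity
      simp only [hu]
      rw [← min_add_add_right]
      apply le_min
      · exact (min_le_left _ _).trans (by linarith)
      · refine (min_le_right _ _).trans (le_of_eq ?_)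
        push_cast
        ring
    linarith
  have hstep : ∀ i ∈ Finset.range n, ∫ t in u i..u (i + 1), ‖γ' t‖ ≤
      ‖γ (u (i + 1)) - γ (u i)‖ + 2 * η * (u (i + 1) - u i) := by
    intro i _
    apply integral_norm_deriv_le_norm_sub_add hd hc (hmono i.le_succ)
    intro t ht
    rw [← dist_eq_norm]
    refine (hδ t ⟨(hmem i).1.trans ht.1, ht.2.trans (hmem (i + 1)).2⟩ _ (hmem i) ?_).le
    rw [Real.dist_eq, abs_of_nonneg (sub_nonneg.2 ht.1)]
    linarith [hwidth i, ht.2]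
  have hsum := Finset.sum_le_sum hstep
  rw [intervalIntegral.sum_integral_adjacent_intervals
    (fun _ _ => hc.norm.intervalIntegrable _ _), hu0, hun, Finset.sum_add_distrib,
    ← Finset.mul_sum, Finset.sum_range_sub, hu0, hun] at hsum
  have hvar : ∑ i ∈ Finset.range n, ‖γ (u (i + 1)) - γ (u i)‖ ≤
      (eVariationOn γ (Set.Icc a b)).toReal := by
    rw [← ENNReal.ofReal_le_iff_le_toReal htop,
      ENNReal.ofReal_sum_of_nonneg fun _ _ => norm_nonneg _]
    have := eVariationOn.sum_le (f := γ) (n := n) hmono hmem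
    simpa only [edist_dist, dist_eq_norm] using this
  have hηε : 2 * η * (b - a) = ε := by
    rw [hη]
    field_simp
  linarith

/-! ### The length of the image of a trigonometric polynomial -/

theorem trigPoly_eq_sum_unitExp (N : ℕ) (a : ℕ → ℂ) (lam : ℕ → ℝ) (t : ℝ) :
    trigPoly N a lam t = ∑ k ∈ Finset.Icc 1 N, a k * unitExp (lam k * t) := by
  refine Finset.sum_congr rfl fun k _ => ?_
  rw [unitExp]
  push_cast
  ring_nf

theorem hasDerivAt_trigPoly (N : ℕ) (a : ℕ → ℂ) (lam : ℕ → ℝ) (t : ℝ) :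
    HasDerivAt (trigPoly N a lam)
      (2 * Real.pi * Complex.I * trigPoly N (fun k => lam k * a k) lam t) t := by
  unfold trigPoly
  rw [Finset.mul_sum]
  apply HasDerivAt.fun_sum
  intro k _
  have h1 : HasDerivAt (fun t : ℝ => 2 * Complex.I * Real.pi * lam k * (t : ℂ))
      (2 * Complex.I * Real.pi * lam k) t := by
    simpa using (Complex.ofRealCLM.hasDerivAt (x := t)).const_mul
      (2 * Complex.I * Real.pi * lam k)
  refine (h1.cexp.const_mul (a k)).congr_deriv ?_
  ring

theorem continuous_trigPoly (N : ℕ) (a : ℕ → ℂ) (lam : ℕ → ℝ) : Continuous (trigPoly N a lam) := by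
  unfold trigPoly
  fun_prop

theorem natCast_sub_le_of_add_one_le {N : ℕ} {lam : ℕ → ℝ}
    (hlam : ∀ k : ℕ, 1 ≤ k → k < N → lam k + 1 ≤ lam (k + 1)) {l k : ℕ} (hl : 1 ≤ l) (hlk : l ≤ k)
    (hk : k ≤ N) : (k : ℝ) - l ≤ lam k - lam l := by
  induction k, hlk using Nat.le_induction with
  | base => simp
  | succ k hlk ih =>
    have h1 := ih (by omega)
    have h2 := hlam k (by omega) (by omega)
    push_cast
    linarith

theorem mainTheorem2 (N : ℕ) (a : ℕ → ℂ) (lam : ℕ → ℝ)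
    (hlam : ∀ k : ℕ, 1 ≤ k → k < N → lam k + 1 ≤ lam (k + 1))
    (T : ℝ) (hT : 72 ≤ T) :
    curveLength (trigPoly N a lam) 0 T =
        ENNReal.ofReal (∫ t in (0 : ℝ)..T, ‖deriv (trigPoly N a lam) t‖) ∧
      T / 20 * ∑ k ∈ Finset.Icc 1 N, |lam k| * ‖a k‖ / (k : ℝ) ≤
        ∫ t in (0 : ℝ)..T, ‖deriv (trigPoly N a lam) t‖ := by
  have hT0 : 0 < T := by linarith
  have hpi := Real.pi_gt_three
  have hderiv : ∀ t, deriv (trigPoly N a lam) t =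
      2 * Real.pi * Complex.I * trigPoly N (fun k => lam k * a k) lam t :=
    fun t => (hasDerivAt_trigPoly N a lam t).deriv
  simp only [hderiv]
  refine ⟨eVariationOn_Icc_eq_integral_norm_deriv (hasDerivAt_trigPoly N a lam)
    ((continuous_trigPoly _ _ _).const_mul _) hT0, ?_⟩
  have hgap : ∀ l k : ℕ, 1 ≤ l → l < k → k ≤ N →
      72 * ((k : ℝ) - l) ≤ T * lam k - T * lam l := by
    intro l k hl hlk hk
    have h1 := natCast_sub_le_of_add_one_le hlam hl hlk.le hk
    have h2 : (l : ℝ) < k := by exact_mod_cast hlk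
    nlinarith
  have hmain := sum_norm_div_le_integral_norm N (fun k => lam k * a k) (fun k => T * lam k) hgap
  have hscale := intervalIntegral.smul_integral_comp_mul_left (a := 0) (b := 1)
    (fun t => ‖2 * Real.pi * Complex.I * trigPoly N (fun k => lam k * a k) lam t‖) T
  rw [mul_zero, mul_one, smul_eq_mul] at hscale
  rw [← hscale]
  have hnorm : ∀ s : ℝ, ‖2 * Real.pi * Complex.I *
      trigPoly N (fun k => lam k * a k) lam (T * s)‖ =
      2 * Real.pi * ‖∑ k ∈ Finset.Icc 1 N, lam k * a k * unitExp (T * lam k * s)‖ := by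
    intro s
    have h : ∀ k, lam k * (T * s) = T * lam k * s := fun k => by ring
    rw [trigPoly_eq_sum_unitExp, norm_mul]
    simp only [h]
    simp [abs_of_pos Real.pi_pos]
  simp only [hnorm, norm_mul, Complex.norm_real, Real.norm_eq_abs] at hmain ⊢
  rw [intervalIntegral.integral_const_mul]
  set S := ∑ k ∈ Finset.Icc 1 N, |lam k| * ‖a k‖ / (k : ℝ) with hS
  have hS0 : 0 ≤ S := Finset.sum_nonneg fun k _ => by positivity
  calc T / 20 * S = T * (2 * 3 * (1 / 120 * S)) := by ring
    _ ≤ T * (2 * Real.pi * (1 / 120 * S)) := by gcongr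
    _ ≤ _ := by gcongr
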